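/- All graphs are finite and simple. For a graph $H$, a \emph{subdivision} of $H$ is obtained by replacing each edge of $H$ by a path of length at least $1$ with new inner vertices. A graph $G$ is a \emph{proper $H$-graph} if there are a subdivision $K$ of $H$ and, for each $v\in V(G)$, a nonempty connected subgraph $R(v)$ of $K$ such that distinct vertices $u,v$ of $G$ are adjacent if and only if $R(u)$ and $R(v)$ share a vertex, and no $R(u)$ is a proper subgraph of any $R(v)$. Let $B$ be the $5$-vertex graph consisting of two triangles that share exactly one vertex. For a class $\mathcal C$ of graphs, the isomorphism problem for $\mathcal C$ is the (promise) problem of deciding, given two graphs in $\mathcal C$, whether they are isomorphic; it is \emph{GI-complete} if there are polynomial-time many-one reductions both from the isomorphism problem for all graphs to it and from it to the isomorphism problem for all graphs. (Graphs on $\{0,\dots,n-1\}$ are given as binary words: $n$ in unary, then the adjacency matrix. Polynomial time refers to multi-stack Turing machines.) For a graph $G=(V,E)$, let $G_1$, with vertex set $V\cup V_1$, be obtained by subdividing each edge of $G$ once; let $G_2$, with vertex set $V\cup V_1\cup V_2$, be obtained by subdividing each edge of $G_1$ once; let $G_3$ be obtained from $G_2$ by adding all edges between $V$ and $V_1$;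 and let $G'$ be the complement of $G_3$. \textbf{Theorem.} (1) The isomorphism problem for the class of all proper $B$-graphs is GI-complete. (2) There is a polynomial-time computable function that maps every graph $G$ to a graph isomorphic to $G'$. (3) For every graph $G$, the graph $G'$ is a proper $B$-graph. (4) If $G$ and $H$ are graphs with minimum degree at least three, then $G$ and $H$ are isomorphic if and only if $G'$ and $H'$ are isomorphic. -/

import Mathlib

/-! ### Subdivisions and `H`-graphs -/

/-- The adjacency of a subdivision, before symmetrization: the edge `e = {a, b}`, `a < b`, is
replaced by the path `a, (e, 0), (e, 1), …, (e, k e - 1), b`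
(by the edge `a, b` itself when `k e = 0`). -/
def subdivisionRel {V : Type*} [LinearOrder V] (H : SimpleGraph V) (k : H.edgeSet → ℕ) :
    V ⊕ (Σ e : H.edgeSet, Fin (k e)) → V ⊕ (Σ e : H.edgeSet, Fin (k e)) → Prop
  | .inl u, .inl v => ∃ h : H.Adj u v, k ⟨s(u, v), h⟩ = 0
  | .inl u, .inr x =>
      (u = x.1.1.inf ∧ (x.2 : ℕ) = 0) ∨ (u = x.1.1.sup ∧ (x.2 : ℕ) + 1 = k x.1)
  | .inr _, .inl _ => False
  | .inr x, .inr y => x.1 = y.1 ∧ (x.2 : ℕ) + 1 = (y.2 : ℕ)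

/-- The subdivision of `H` in which every edge `e` receives `k e` new inner vertices. The linear
order on `V` only serves to number the new vertices along each edge. -/
def subdivision {V : Type*} [LinearOrder V] (H : SimpleGraph V) (k : H.edgeSet → ℕ) :
    SimpleGraph (V ⊕ (Σ e : H.edgeSet, Fin (k e))) :=
  SimpleGraph.fromRel (subdivisionRel H k)

/-- `R` represents `G` as the intersection graph of connected (nonempty) subgraphs of `K`. -/
structure IsRepresentation {V W : Type*} (K : SimpleGraph W) (G : SimpleGraph V)
    (R : V → K.Subgraph) : Prop where
  connected : ∀ v, (R v).Connected
  adj_iff : ∀ u v, u ≠ v → (G.Adj u v ↔ ((R u).verts ∩ (R v).verts).Nonempty)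

/-- `G` is a proper `H`-graph: it has a representation in some subdivision of `H` in which no
subgraph is properly contained in another one. -/
def IsProperHGraph {U V : Type*} [LinearOrder U] (H : SimpleGraph U) (G : SimpleGraph V) : Prop :=
  ∃ (k : H.edgeSet → ℕ) (R : V → (subdivision H k).Subgraph),
    IsRepresentation (subdivision H k) G R ∧ ∀ u v, ¬ R u < R v

/-- The graph `B`: two triangles `0, 1, 2` and `0, 3, 4` sharing the vertex `0`. -/
def graphB : SimpleGraph (Fin 5) :=
  SimpleGraph.fromEdgeSet {s(0, 1), s(0, 2), s(1, 2), s(0, 3), s(0, 4), s(3, 4)}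

/-! ### The construction -/

/-- Subdivide every edge of `G` exactly once; the new vertices are the edges of `G`. -/
def subdivideOnce {V : Type*} (G : SimpleGraph V) : SimpleGraph (V ⊕ G.edgeSet) :=
  SimpleGraph.fromRel fun x y => match x, y with
    | .inl v, .inr e => v ∈ (e : Sym2 V)
    | _, _ => False

/-- The vertices of the graph obtained from `G` by subdividing every edge and then subdividing
every edge again: `inl (inl v)` are the original vertices (`V`), `inl (inr e)` those of the first
subdivision (`V₁`), and `inr e` those of the second one (`V₂`). -/
abbrev PrimeVertex {V : Type*} (G : SimpleGraph V) : Type _ :=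
  (V ⊕ G.edgeSet) ⊕ (subdivideOnce G).edgeSet

/-- All edges between `V` and `V₁`. -/
def joinOriginalFirst {V : Type*} (G : SimpleGraph V) : SimpleGraph (PrimeVertex G) :=
  SimpleGraph.fromRel fun x y => match x, y with
    | .inl (.inl _), .inl (.inr _) => True
    | _, _ => False

/-- The graph `G'`: subdivide every edge of `G`, subdivide every edge of the result, add all edges
between `V` and `V₁`, and take the complement. -/
def primeGraph {V : Type*} (G : SimpleGraph V) : SimpleGraph (PrimeVertex G) :=
  (subdivideOnce (subdivideOnce G) ⊔ joinOriginalFirst G)ᶜ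

/-! ### Finite graphs as inputs of machines -/

/-- Finite graphs, with vertex set `{0, …, n - 1}`. -/
abbrev FinGraph : Type := Σ n : ℕ, SimpleGraph (Fin n)

namespace FinGraph

/-- Isomorphism of finite graphs. -/
def Isomorphic (G H : FinGraph) : Prop := Nonempty (G.2 ≃g H.2)

open Classical in
/-- The number of vertices in unary, ended by `false`, followed by the rows of the adjacency
matrix. -/
noncomputable def bits (G : FinGraph) : List Bool :=
  List.replicate G.1 true ++ false ::
    ((List.finRange G.1).flatMap fun i => (List.finRange G.1).map fun j => decide (G.2.Adj i j))

theorem unary_prefix_inj (m n : ℕ) (x y : List Bool)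
    (h : List.replicate m true ++ false :: x = List.replicate n true ++ false :: y) :
    m = n ∧ x = y := by
  induction m generalizing n with
  | zero => cases n <;> simp_all [List.replicate_succ]
  | succ m ih =>
    cases n with
    | zero => simp [List.replicate_succ] at h
    | succ n =>
      simp only [List.replicate_succ, List.cons_append, List.cons.injEq, true_and] at h
      obtain ⟨h₁, h₂⟩ := ih n h
      exact ⟨by rw [h₁], h₂⟩

theorem flatMap_prefix_inj {ι : Type*} (f g : ι → List Bool)
    (hfg : ∀ i, (f i).length = (g i).length) (l : List ι) (s t : List Bool)
    (h : l.flatMap f ++ s = l.flatMap g ++ t) : (∀ i ∈ l, f i = g i) ∧ s = t := by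
  induction l with
  | nil => simpa using h
  | cons a l ih =>
    simp only [List.flatMap_cons, List.append_assoc] at h
    obtain ⟨h₁, h₂⟩ := List.append_inj h (hfg a)
    obtain ⟨h₃, h₄⟩ := ih h₂
    exact ⟨by simpa using ⟨h₁, h₃⟩, h₄⟩

/-- The coding of graphs is injective and self-delimiting. -/
theorem bits_append_inj (G H : FinGraph) (s t : List Bool)
    (h : G.bits ++ s = H.bits ++ t) : G = H ∧ s = t := by
  obtain ⟨m, G⟩ := G
  obtain ⟨n, H⟩ := H
  simp only [bits, List.append_assoc, List.cons_append] at h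
  obtain ⟨rfl, h⟩ := unary_prefix_inj _ _ _ _ h
  obtain ⟨h₁, h₂⟩ := flatMap_prefix_inj _ _ (by simp) _ _ _ h
  refine ⟨?_, h₂⟩
  congr 1
  ext i j
  have := h₁ i (List.mem_finRange i)
  simpa using (List.map_inj_left.1 this) j (List.mem_finRange j)

/-- Finite graphs as binary words. -/
noncomputable def encoding : Computability.Encoding FinGraph Bool where
  encode := bits
  decode := Function.partialInv bits
  decode_encode := Function.partialInv_left fun G H h =>
    (bits_append_inj G H [] [] (by simpa using h)).1

/-- Pairs of finite graphs as binary words: the two codes one after the other. -/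
noncomputable def pairEncoding : Computability.Encoding (FinGraph × FinGraph) Bool where
  encode p := p.1.bits ++ p.2.bits
  decode := Function.partialInv fun p : FinGraph × FinGraph => p.1.bits ++ p.2.bits
  decode_encode := Function.partialInv_left fun p q h => by
    obtain ⟨h₁, h₂⟩ := bits_append_inj p.1 q.1 p.2.bits q.2.bits h
    exact Prod.ext h₁ (bits_append_inj p.2 q.2 [] [] (by simpa using h₂)).1

end FinGraph

/-! ### Polynomial-time reductions -/

/-- `f` is computed by a (multi-stack) Turing machine in time polynomial in the input length. -/
def PolyTime {α β : Type} (ea : Computability.Encoding α Bool) (eb : Computability.Encoding β Bool)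
    (f : α → β) : Prop :=
  Nonempty (Turing.TM2ComputableInPolyTime ea.encode eb.encode f)

/-- A decision problem whose inputs are promised to lie in a given set. -/
structure PromiseProblem where
  /-- inputs -/
  Input : Type
  /-- inputs as binary words -/
  encoding : Computability.Encoding Input Bool
  /-- the inputs that may occur -/
  promise : Set Input
  /-- the inputs with answer yes -/
  yes : Set Input

namespace PromiseProblem

/-- Polynomial-time many-one reducibility. -/
def Reduces (P Q : PromiseProblem) : Prop :=
  ∃ f : P.Input → Q.Input, PolyTime P.encoding Q.encoding f ∧
    ∀ x ∈ P.promise, f x ∈ Q.promise ∧ (x ∈ P.yes ↔ f x ∈ Q.yes)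

/-- The isomorphism problem for a class `C` of finite graphs: given two members of `C`, decide
whether they are isomorphic. -/
noncomputable def isomorphism (C : Set FinGraph) : PromiseProblem where
  Input := FinGraph × FinGraph
  encoding := FinGraph.pairEncoding
  promise := {p | p.1 ∈ C ∧ p.2 ∈ C}
  yes := {p | p.1.Isomorphic p.2}

/-- GI-completeness: equivalence with the isomorphism problem for all finite graphs, under
polynomial-time many-one reductions. -/
def GIComplete (P : PromiseProblem) : Prop :=
  (isomorphism Set.univ).Reduces P ∧ P.Reduces (isomorphism Set.univ)

end PromiseProblem

/-!
The graph `G'` has one vertex for every vertex, every edge and every dart (half-edge) of `G`. The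
vertices of `G` form a clique of `G'`, and so do the edges and the darts; vertices and edges are
never adjacent, and a dart is adjacent to all vertices and edges except for the vertex where it
starts and the edge to which it belongs.

*`G'` is a proper `B`-graph* (`isProperHGraph_primeGraph`). Subdividing the edges of `B` opposite to
its center gives two long cycles through the center. The `n` vertices become the arcs of length `n`
of a path of length `2 n` on the first cycle, and the edges similar arcs on the second cycle; a dart
becomes the complement of the two arcs that it has to avoid. Arcs of one length, and complements of
such arcs, are incomparable.

*`G` can be recovered from `G'`* if every vertex has three neighbors
(`ThreeNeighbors.nonempty_iso`). In `G'` the darts are exactly the vertices with at most two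
non-neighbors; among the others, the edges are those with at most two darts as non-neighbors, and
two vertices are adjacent in `G` if and only if they start darts of a common edge. Adding four
universal vertices to an arbitrary graph gives every vertex three neighbors and can be undone up to
isomorphism (`nonempty_pad_iso_iff`), since a universal vertex can be cancelled. So
`G ↦ (G + 4 universal vertices)'` reduces graph isomorphism to isomorphism of proper `B`-graphs.

*Polynomial time.* Structured programs on stacks, with a big-step semantics that counts steps, are
compiled to Mathlib's stack machines step by step (`StackProg.Exec.iterate_step`). On top of these
there are loop programs whose variables range over the numbers of the vertices, whose tests are
Boolean combinations of `x < y` and of adjacency, and which output bits: `Testable` and `Emits` say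
that a test or an output is available within a polynomial bound, and are closed under the evident
operations. The vertices of `G'` are coded by triples of vertices of `G`, with a quantifier-free
description of validity and of adjacency, so the adjacency matrix of `G'` is the output of six
nested loops (`emits_primeWord`). It remains to read a graph and to add universal vertices
(`StackProg.exists_runs_load`).
-/

/-! ### Structured programs on stacks -/

/-- Structured programs acting on stacks of bits indexed by `K` and on a register that holds the
result of the last `pop`. -/
inductive StackProg (K : Type) : Type
  /-- push a bit that depends on the register -/
  | push (k : K) (f : Option Bool → Bool)
  /-- pop a stack into the register; an empty stack gives `none` -/
  | pop (k : K)
  /-- modify the register -/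
  | set (f : Option Bool → Option Bool)
  /-- one program after the other -/
  | seq (p q : StackProg K)
  /-- branching on the register -/
  | ite (c : Option Bool → Bool) (p q : StackProg K)
  /-- repeat `p` as long as the register satisfies `c` -/
  | loop (c : Option Bool → Bool) (p : StackProg K)

namespace StackProg

variable {K : Type}

section Semantics

variable [DecidableEq K]

/-- Big-step semantics: `Exec p c n c'` says that `p` takes the configuration `c` to `c'` in exactly
`n` steps. -/
inductive Exec : StackProg K → Option Bool × (K → List Bool) → ℕ →
    Option Bool × (K → List Bool) → Prop
  | push (k f σ s) : Exec (.push k f) (σ, s) 1 (σ, Function.update s k (f σ :: s k))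
  | pop (k σ s) : Exec (.pop k) (σ, s) 1 ((s k).head?, Function.update s k (s k).tail)
  | set (f σ s) : Exec (.set f) (σ, s) 1 (f σ, s)
  | seq {p q c₁ n₁ c₂ n₂ c₃} :
      Exec p c₁ n₁ c₂ → Exec q c₂ n₂ c₃ → Exec (.seq p q) c₁ (n₁ + n₂) c₃
  | ite_true {c p q σ s n c'} :
      c σ = true → Exec p (σ, s) n c' → Exec (.ite c p q) (σ, s) (1 + n) c'
  | ite_false {c p q σ s n c'} :
      c σ = false → Exec q (σ, s) n c' → Exec (.ite c p q) (σ, s) (1 + n) c'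
  | loop_done {c p σ s} : c σ = false → Exec (.loop c p) (σ, s) 1 (σ, s)
  | loop_step {c p σ s n c' m c''} : c σ = true → Exec p (σ, s) n c' →
      Exec (.loop c p) c' m c'' → Exec (.loop c p) (σ, s) (1 + n + m) c''

/-- A program can lengthen a stack by at most one bit per step. -/
theorem Exec.length_le {p : StackProg K} {c c' : Option Bool × (K → List Bool)} {n : ℕ}
    (h : Exec p c n c') (k : K) : (c'.2 k).length ≤ (c.2 k).length + n := by
  induction h with
  | push k' f σ s =>
    rcases eq_or_ne k k' with rfl | hk
    · simp
    · simp [hk]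
  | pop k' σ s =>
    rcases eq_or_ne k k' with rfl | hk
    · simp; omega
    · simp [hk]
  | set => simp
  | seq _ _ h₁ h₂ => omega
  | ite_true _ _ h => simp at h ⊢; omega
  | ite_false _ _ h => simp at h ⊢; omega
  | loop_done => simp
  | loop_step _ _ _ h₁ h₂ => simp at h₁ h₂ ⊢; omega

/-- `p` takes the configuration `c` to `c'` in at most `t` steps. -/
def Runs (p : StackProg K) (c : Option Bool × (K → List Bool)) (t : ℕ)
    (c' : Option Bool × (K → List Bool)) : Prop :=
  ∃ n ≤ t, Exec p c n c'

end Semantics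

/-! ### Compilation to stack machines -/

/-- The program points of a structured program: one for each instruction and, as `none`, one for each
test of a branching or a loop. -/
def Label : StackProg K → Type
  | push _ _ | pop _ | set _ => Unit
  | seq p q => Label p ⊕ Label q
  | ite _ p q => Option (Label p ⊕ Label q)
  | loop _ p => Option (Label p)

/-- There are finitely many program points. -/
noncomputable instance Label.fintype : (p : StackProg K) → Fintype (Label p)
  | push _ _ | pop _ | set _ => inferInstanceAs (Fintype Unit)
  | seq p q =>
    haveI := Label.fintype p; haveI := Label.fintype q
    inferInstanceAs (Fintype (Label p ⊕ Label q))
  | ite _ p q =>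
    haveI := Label.fintype p; haveI := Label.fintype q
    inferInstanceAs (Fintype (Option (Label p ⊕ Label q)))
  | loop _ p =>
    haveI := Label.fintype p
    inferInstanceAs (Fintype (Option (Label p)))

/-- The program point at which a program starts. -/
def entry : (p : StackProg K) → Label p
  | push _ _ | pop _ | set _ => ()
  | seq p _ => Sum.inl (entry p)
  | ite _ _ _ => none
  | loop _ _ => none

open Turing

/-- The machine statements of a program whose program points are embedded by `ι` in the labels of a
larger machine and which continues with the statement `exit`. -/
def code {L : Type} : (p : StackProg K) → (Label p → L) →
    TM2.Stmt (fun _ : K => Bool) L (Option Bool) →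
    Label p → TM2.Stmt (fun _ : K => Bool) L (Option Bool)
  | push k f, _, exit, _ => .push k f exit
  | pop k, _, exit, _ => .pop k (fun _ o => o) exit
  | set f, _, exit, _ => .load f exit
  | seq p q, ι, _, .inl l =>
      code p (fun l => ι (.inl l)) (.goto fun _ => ι (.inr (entry q))) l
  | seq _ q, ι, exit, .inr l => code q (fun l => ι (.inr l)) exit l
  | ite c p q, ι, _, none =>
      .branch c (.goto fun _ => ι (some (.inl (entry p))))
        (.goto fun _ => ι (some (.inr (entry q))))
  | ite _ p _, ι, exit, some (.inl l) => code p (fun l => ι (some (.inl l))) exit l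
  | ite _ _ q, ι, exit, some (.inr l) => code q (fun l => ι (some (.inr l))) exit l
  | loop c p, ι, exit, none => .branch c (.goto fun _ => ι (some (entry p))) exit
  | loop _ p, ι, _, some l => code p (fun l => ι (some l)) (.goto fun _ => ι none) l

variable [DecidableEq K]

/-- The compiled code simulates the big-step semantics step by step. -/
theorem Exec.iterate_step {L : Type} (M : L → TM2.Stmt (fun _ : K => Bool) L (Option Bool))
    {p : StackProg K} {c c' : Option Bool × (K → List Bool)} {n : ℕ} (h : Exec p c n c') :
    ∀ (ι : Label p → L) (exit : TM2.Stmt (fun _ : K => Bool) L (Option Bool)),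
      (∀ l, M (ι l) = code p ι exit l) →
      (flip bind (TM2.step M))^[n] (some ⟨some (ι (entry p)), c.1, c.2⟩) =
        some (TM2.stepAux exit c'.1 c'.2) := by
  have one : ∀ (l : L) (σ : Option Bool) (s : K → List Bool),
      (flip bind (TM2.step M))^[1] (some ⟨some l, σ, s⟩) = some (TM2.stepAux (M l) σ s) :=
    fun _ _ _ => rfl
  induction h with
  | push k f σ s => intro ι exit hM; rw [one, hM]; rfl
  | pop k σ s => intro ι exit hM; rw [one, hM]; rfl
  | set f σ s => intro ι exit hM; rw [one, hM]; rfl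
  | @seq p q c₁ n₁ c₂ n₂ c₃ h₁ h₂ ih₁ ih₂ =>
    intro ι exit hM
    rw [add_comm, Function.iterate_add_apply]
    have e₁ := ih₁ (fun l => ι (.inl l)) (.goto fun _ => ι (.inr (entry q)))
      (fun l => hM (.inl l))
    have e₂ := ih₂ (fun l => ι (.inr l)) exit (fun l => hM (.inr l))
    exact (congrArg _ e₁).trans e₂
  | @ite_true c p q σ s n c' hc h ih =>
    intro ι exit hM
    rw [add_comm, Function.iterate_add_apply, one, hM]
    have e := ih (fun l => ι (some (.inl l))) exit (fun l => hM (some (.inl l)))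
    simpa [entry, code, hc] using e
  | @ite_false c p q σ s n c' hc h ih =>
    intro ι exit hM
    rw [add_comm, Function.iterate_add_apply, one, hM]
    have e := ih (fun l => ι (some (.inr l))) exit (fun l => hM (some (.inr l)))
    simpa [entry, code, hc] using e
  | @loop_done c p σ s hc =>
    intro ι exit hM
    rw [one, hM]
    simp [entry, code, hc]
  | @loop_step c p σ s n c' m c'' hc h₁ h₂ ih₁ ih₂ =>
    intro ι exit hM
    rw [add_comm, Function.iterate_add_apply, add_comm 1 n, Function.iterate_add_apply, one, hM]
    have e₁ := ih₁ (fun l => ι (some l)) (.goto fun _ => ι none) (fun l => hM (some l))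
    have e₂ := ih₂ ι exit hM
    have e₃ : TM2.stepAux (code (loop c p) ι exit (loop c p).entry) σ s =
        ⟨some (ι (some (entry p))), σ, s⟩ := by
      simp [entry, code, hc]
    rw [e₃]
    exact (congrArg _ e₁).trans e₂

/-- The machine of a program, with input stack `k₀` and output stack `k₁`. -/
noncomputable def machine [Fintype K] (p : StackProg K) (k₀ k₁ : K) : FinTM2 where
  K := K
  k₀ := k₀
  k₁ := k₁
  Γ := fun _ => Bool
  Λ := Label p
  main := entry p
  σ := Option Bool
  initialState := none
  Γk₀Fin := inferInstanceAs (Fintype Bool)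
  m := code p id .halt

theorem initList_machine [Fintype K] (p : StackProg K) (k₀ k₁ : K) (w : List Bool) :
    initList (machine p k₀ k₁) w =
      ⟨some (entry p), none, Function.update (fun _ => []) k₀ w⟩ := by
  unfold initList
  congr 1
  funext (k : K)
  rcases eq_or_ne k k₀ with rfl | hk
  · exact (dif_pos rfl).trans (Function.update_self (β := fun _ => List Bool) ..).symm
  · exact (dif_neg hk).trans
      (Function.update_of_ne (β := fun _ => List Bool) hk w (fun _ => [])).symm

theorem haltList_machine [Fintype K] (p : StackProg K) (k₀ k₁ : K) (w : List Bool) :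
    haltList (machine p k₀ k₁) w = ⟨none, none, Function.update (fun _ => []) k₁ w⟩ := by
  unfold haltList
  congr 1
  funext (k : K)
  rcases eq_or_ne k k₁ with rfl | hk
  · exact (dif_pos rfl).trans (Function.update_self (β := fun _ => List Bool) ..).symm
  · exact (dif_neg hk).trans
      (Function.update_of_ne (β := fun _ => List Bool) hk w (fun _ => [])).symm

/-- A function is computed in polynomial time if some program moves the code of each argument, on an
otherwise empty memory, to the code of the value, and does so within a polynomial bound. -/
theorem polyTime_of_runs [Fintype K] {α β : Type} {ea : Computability.Encoding α Bool}
    {eb : Computability.Encoding β Bool} {f : α → β} (p : StackProg K) (k₀ k₁ : K)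
    (T : Polynomial ℕ)
    (h : ∀ a, Runs p (none, Function.update (fun _ => []) k₀ (ea.encode a))
      (T.eval (ea.encode a).length) (none, Function.update (fun _ => []) k₁ (eb.encode (f a)))) :
    PolyTime ea eb f := by
  refine ⟨{ tm := machine p k₀ k₁, inputAlphabet := Equiv.refl Bool,
            outputAlphabet := Equiv.refl Bool, time := T, outputsFun := fun a => ?_ }⟩
  have h' := h a
  refine ⟨⟨h'.choose, ?_⟩, h'.choose_spec.1⟩
  have e := h'.choose_spec.2.iterate_step (code p id .halt) id .halt (fun l => rfl)
  have hw : ∀ w : List Bool, w.map (Equiv.refl Bool).invFun = w := fun w => List.map_id w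
  refine (congrArg _ (congrArg some ?_)).trans (e.trans (congrArg some ?_).symm)
  · exact (congrArg _ (hw _)).trans (initList_machine p k₀ k₁ _)
  · exact (congrArg _ (hw _)).trans (haltList_machine p k₀ k₁ _)

end StackProg

/-! ### Loops over stacks -/

namespace StackProg

variable {K : Type} [DecidableEq K]

section Runs

variable {p q : StackProg K} {c c' c'' : Option Bool × (K → List Bool)} {t t' : ℕ}

theorem Runs.mono (h : Runs p c t c') (ht : t ≤ t') : Runs p c t' c' :=
  let ⟨n, hn, e⟩ := h; ⟨n, hn.trans ht, e⟩

theorem Runs.congr {σ σ' : Option Bool} {s s₁ s' s₁' : K → List Bool}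
    (h : Runs p (σ, s) t (σ', s')) (hs : s = s₁) (hs' : s' = s₁') (ht : t ≤ t') :
    Runs p (σ, s₁) t' (σ', s₁') :=
  hs ▸ hs' ▸ h.mono ht

theorem Runs.seq (h : Runs p c t c') (h' : Runs q c' t' c'') : Runs (seq p q) c (t + t') c'' :=
  let ⟨_, hn, e⟩ := h; let ⟨_, hm, e'⟩ := h'; ⟨_, Nat.add_le_add hn hm, e.seq e'⟩

theorem runs_push (k : K) (f σ s) :
    Runs (push k f) (σ, s) 1 (σ, Function.update s k (f σ :: s k)) :=
  ⟨_, le_rfl, .push ..⟩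

theorem runs_pop (k : K) (σ s) :
    Runs (pop k) (σ, s) 1 ((s k).head?, Function.update s k (s k).tail) :=
  ⟨_, le_rfl, .pop ..⟩

theorem runs_set (f σ) (s : K → List Bool) : Runs (set f) (σ, s) 1 (f σ, s) :=
  ⟨_, le_rfl, .set ..⟩

theorem Runs.ite {b : Option Bool → Bool} {σ : Option Bool} {s : K → List Bool}
    (hp : b σ = true → Runs p (σ, s) t c') (hq : b σ = false → Runs q (σ, s) t c') :
    Runs (ite b p q) (σ, s) (1 + t) c' := by
  cases hb : b σ with
  | true => obtain ⟨n, hn, e⟩ := hp hb; exact ⟨_, by omega, .ite_true hb e⟩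
  | false => obtain ⟨n, hn, e⟩ := hq hb; exact ⟨_, by omega, .ite_false hb e⟩

theorem Runs.loop_step {b : Option Bool → Bool} {σ : Option Bool} {s : K → List Bool}
    (hb : b σ = true) (h : Runs p (σ, s) t c') (h' : Runs (loop b p) c' t' c'') :
    Runs (loop b p) (σ, s) (1 + t + t') c'' :=
  let ⟨_, hn, e⟩ := h
  let ⟨_, hm, e'⟩ := h'
  ⟨_, by omega, .loop_step hb e e'⟩

end Runs

/-- Push the bit in the register. -/
def pushBit (k : K) : StackProg K := push k fun σ => σ == some true

/-- Empty the stack `k`, running `p` after each pop. -/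
def forPop (k : K) (p : StackProg K) : StackProg K :=
  seq (pop k) (loop Option.isSome (seq p (pop k)))

/-- `S l` is the memory before the iteration that finds the stack `k` with content `l`; the body
starts after the pop, with the popped bit in the register. -/
theorem runs_forPop {k : K} {p : StackProg K} {T : ℕ} (S : List Bool → K → List Bool)
    (l₀ : List Bool) (hS : ∀ l, S l k = l)
    (step : ∀ a l, a :: l <:+ l₀ →
      ∃ σ', Runs p (some a, Function.update (S (a :: l)) k l) T (σ', S l)) (σ : Option Bool) :
    Runs (forPop k p) (σ, S l₀) (l₀.length * (T + 2) + 2) (none, S []) := by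
  have key : ∀ l, l <:+ l₀ →
      Runs (loop Option.isSome (seq p (pop k))) (l.head?, Function.update (S l) k l.tail)
        (l.length * (T + 2) + 1) (none, S []) := by
    intro l
    induction l with
    | nil =>
      intro _
      have e : Function.update (S []) k [] = S [] := Function.update_eq_self_iff.2 (hS _).symm
      rw [List.head?_nil, List.tail_nil, e]
      exact ⟨1, by simp, .loop_done rfl⟩
    | cons a l ih =>
      intro hl
      obtain ⟨σ', h₁⟩ := step a l hl
      have h₂ := h₁.seq (runs_pop k σ' (S l))
      rw [hS] at h₂
      refine (Runs.loop_step rfl h₂ (ih ((List.suffix_cons a l).trans hl))).mono ?_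
      simp only [List.length_cons, Nat.add_mul]
      omega
  have h := (runs_pop k σ (S l₀)).seq (by rw [hS]; exact key l₀ (List.suffix_refl _))
  exact h.mono (by omega)

/-- Pour the stack `a` onto the stack `b`. -/
def move (a b : K) : StackProg K := forPop a (pushBit b)

theorem runs_move {a b : K} (hab : a ≠ b) (σ) (s : K → List Bool) :
    Runs (move a b) (σ, s) ((s a).length * 3 + 2)
      (none, Function.update (Function.update s a []) b ((s a).reverse ++ s b)) := by
  have h := runs_forPop (k := a) (p := pushBit b) (T := 1)
    (fun l => Function.update (Function.update s a l) b
      (((s a).take ((s a).length - l.length)).reverse ++ s b)) (s a) (by simp [hab]) ?_ σ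
  · exact h.congr (by simp) (by simp) le_rfl
  · intro x l hl
    refine ⟨some x, (runs_push b _ (some x) _).congr rfl ?_ le_rfl⟩
    obtain ⟨l', hl'⟩ := hl
    have e₁ : (s a).length - (l.length + 1) = l'.length := by simp [← hl']
    have e₂ : (s a).length - l.length = l'.length + 1 := by simp [← hl']; omega
    funext k
    rcases eq_or_ne k b with rfl | hb
    · simp only [List.length_cons, e₁, e₂]
      simp [← hl', hab.symm, List.take_append]
    · rcases eq_or_ne k a with rfl | ha <;> simp [*]

/-- Empty the stack `a`. -/
def clear (a : K) : StackProg K := forPop a (set id)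

theorem runs_clear (a : K) (σ) (s : K → List Bool) :
    Runs (clear a) (σ, s) ((s a).length * 3 + 2) (none, Function.update s a []) := by
  have h := runs_forPop (k := a) (p := set id) (T := 1) (fun l => Function.update s a l) (s a)
    (by simp) (fun x l _ => ⟨some x, by simpa using runs_set id (some x) _⟩) σ
  exact h.congr (by simp) rfl le_rfl

/-- Run `p` once for every element of the stack `k`, whose content is kept; `t` is scratch. -/
def forCopy (k t : K) (p : StackProg K) : StackProg K :=
  seq (forPop k (seq (pushBit t) p)) (move t k)

/-- `S i` is the memory after `i` iterations. During the loop the content of `k` is distributed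
over `k` and `t`, so the body must work for every content of these two stacks. -/
theorem runs_forCopy {k t : K} (hkt : k ≠ t) {p : StackProg K} {T : ℕ} (S : ℕ → K → List Bool)
    (l₀ : List Bool) (hk : ∀ i, S i k = l₀) (ht : ∀ i, S i t = [])
    (step : ∀ i < l₀.length, ∀ σ l l', ∃ σ',
      Runs p (σ, Function.update (Function.update (S i) k l) t l') T
        (σ', Function.update (Function.update (S (i + 1)) k l) t l')) (σ : Option Bool) :
    Runs (forCopy k t p) (σ, S 0) (l₀.length * (T + 6) + 4) (none, S l₀.length) := by
  have h := runs_forPop (k := k) (p := seq (pushBit t) p) (T := 1 + T)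
    (fun l => Function.update (Function.update (S (l₀.length - l.length)) k l) t
      (l₀.take (l₀.length - l.length)).reverse) l₀ (by simp [hkt]) ?_ σ
  · have h' := h.seq (runs_move hkt.symm none _)
    refine h'.congr ?_ ?_ ?_
    · funext x
      rcases eq_or_ne x t with rfl | hx
      · simp [ht]
      · rcases eq_or_ne x k with rfl | hx' <;> simp [*]
    · funext x
      rcases eq_or_ne x k with rfl | hx
      · simp [hk, hkt]
      · rcases eq_or_ne x t with rfl | hx' <;> simp [*]
    · simp
      ring_nf
      omega
  · intro a l hl
    obtain ⟨l', hl'⟩ := hl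
    have e₁ : l₀.length - (l.length + 1) = l'.length := by simp [← hl']
    have e₂ : l₀.length - l.length = l'.length + 1 := by simp [← hl']; omega
    obtain ⟨σ', h⟩ := step l'.length (by simp [← hl']) (some a) l (a :: l'.reverse)
    refine ⟨σ', (runs_push t _ (some a) _).seq (h.congr ?_ ?_ le_rfl)⟩
    · simp only [List.length_cons, e₁]
      funext x
      rcases eq_or_ne x t with rfl | hx'
      · simp [← hl', hkt.symm]
      · rcases eq_or_ne x k with rfl | hx <;> simp [*]
    · simp only [e₂]
      simp [← hl', List.take_append, List.take_of_length_le]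

/-- Copy the stack `a` on top of the stack `b`; `t` is scratch. -/
def copy (a b t : K) : StackProg K :=
  seq (move a t) (forPop t (seq (pushBit a) (pushBit b)))

theorem runs_copy {a b t : K} (hab : a ≠ b) (hat : a ≠ t) (hbt : b ≠ t) (σ) (s : K → List Bool)
    (ht : s t = []) :
    Runs (copy a b t) (σ, s) ((s a).length * 7 + 4) (none, Function.update s b (s a ++ s b)) := by
  have h := runs_forPop (k := t) (p := seq (pushBit a) (pushBit b)) (T := 2)
    (fun l => Function.update (Function.update (Function.update s t l) a
      (((s a).reverse.take ((s a).length - l.length)).reverse)) b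
      (((s a).reverse.take ((s a).length - l.length)).reverse ++ s b))
    (s a).reverse (by simp [hat.symm, hbt.symm]) ?_ none
  · refine ((runs_move hat σ s).seq (h.congr ?_ ?_ le_rfl)).mono ?_
    · funext x
      rcases eq_or_ne x b with rfl | hb
      · simp [hab.symm, *]
      · rcases eq_or_ne x a with rfl | ha
        · simp [*]
        · simp [Function.update_apply, *]
    · have e : (s a).reverse.take (s a).length = (s a).reverse :=
        List.take_of_length_le (by simp)
      funext x
      rcases eq_or_ne x b with rfl | hb
      · simp [e]
      · rcases eq_or_ne x a with rfl | ha
        · simp [*]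
        · simp only [Function.update_apply]; split_ifs <;> simp_all
    · simp only [List.length_reverse]; omega
  · intro x l hl
    refine ⟨some x, ((runs_push a _ (some x) _).seq (runs_push b _ (some x) _)).congr rfl ?_ le_rfl⟩
    obtain ⟨l', hl'⟩ := hl
    have e₀ : (s a).length = l'.length + (l.length + 1) := by
      rw [← List.length_reverse, ← hl']; simp
    have e₁ : (s a).length - (l.length + 1) = l'.length := by omega
    have e₂ : (s a).length - l.length = l'.length + 1 := by omega
    simp only [List.length_cons, e₁, e₂, ← hl']
    funext k
    rcases eq_or_ne k b with rfl | hb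
    · simp [hab.symm, hbt, List.take_append, List.take_of_length_le]
    · rcases eq_or_ne k a with rfl | ha
      · simp [hb, hat, List.take_append]
      · simp only [Function.update_apply]; split_ifs <;> simp_all

/-- Run `p`, then reset the register to a bit that tells whether it held `true` before. -/
def keep (p : StackProg K) : StackProg K :=
  ite (fun σ => σ == some true) (seq p (set fun _ => some true)) (seq p (set fun _ => some false))

theorem runs_keep {p : StackProg K} {s s' : K → List Bool} {t : ℕ} {σ σ' : Option Bool}
    (h : Runs p (σ, s) t (σ', s')) :
    Runs (keep p) (σ, s) (t + 2) (some (σ == some true), s') :=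
  (Runs.ite (fun hb => by rw [hb]; exact h.seq (runs_set ..))
    (fun hb => by rw [hb]; exact h.seq (runs_set ..))).mono (by omega)

/-- Run `p` a fixed number of times. -/
def repeatProg : ℕ → StackProg K → StackProg K
  | 0, _ => set id
  | c + 1, p => seq p (repeatProg c p)

theorem runs_repeatProg {p : StackProg K} {T c : ℕ} (S : ℕ → K → List Bool)
    (step : ∀ i < c, ∀ σ, ∃ σ', Runs p (σ, S i) T (σ', S (i + 1))) (σ : Option Bool) :
    ∃ σ', Runs (repeatProg c p) (σ, S 0) (c * T + 1) (σ', S c) := by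
  induction c generalizing S σ with
  | zero => exact ⟨σ, (runs_set id σ (S 0)).mono (by simp)⟩
  | succ c ih =>
    obtain ⟨σ₁, h₁⟩ := step 0 (by omega) σ
    obtain ⟨σ₂, h₂⟩ := ih (fun i => S (i + 1)) (fun i hi => step (i + 1) (by omega)) σ₁
    exact ⟨σ₂, (h₁.seq h₂).mono (by ring_nf; omega)⟩

/-- Copy `a` to the scratch stack `b`, run `p`, pop `b` and empty it; the popped bit decides about
the final register. -/
def test (a b t : K) (p : StackProg K) : StackProg K :=
  seq (copy a b t) (seq p (seq (pop b) (keep (clear b))))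

/-- If `p` drops `m` bits of the copy, then the test asks whether the bit number `m` of `a` exists and
is `true`. -/
theorem runs_test {a b t : K} (hab : a ≠ b) (hat : a ≠ t) (hbt : b ≠ t) {p : StackProg K} {T m : ℕ}
    (s : K → List Bool) (ht : s t = []) (hb : s b = [])
    (hp : ∀ σ, ∃ σ', Runs p (σ, Function.update s b (s a)) T
      (σ', Function.update s b ((s a).drop m))) (σ : Option Bool) :
    Runs (test a b t p) (σ, s) ((s a).length * 10 + T + 9)
      (some ((s a)[m]? == some true), s) := by
  obtain ⟨σ', h⟩ := hp none
  have h₁ := runs_copy hab hat hbt σ s ht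
  rw [hb, List.append_nil] at h₁
  have h₂ := h₁.seq (h.seq ((runs_pop b _ _).seq (runs_keep (runs_clear b _ _))))
  simp only [Function.update_self, List.head?_drop, Function.update_idem] at h₂
  refine h₂.congr rfl (Function.update_eq_self_iff.2 hb.symm) ?_
  simp only [List.length_tail, List.length_drop]
  omega

end StackProg

/-! ### Loop programs over the vertices of a graph -/

/-- The entries `A i j`, `i, j < n`, row by row. -/
def rowMajor (n : ℕ) (A : ℕ → ℕ → Bool) : List Bool :=
  (List.range n).flatMap fun i => (List.range n).map (A i)

/-- The first of `k + 1` rows, where the rows are numbered from `m` on. -/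
theorem flatMap_rows_append (n m : ℕ) (A : ℕ → ℕ → Bool) (k : ℕ) :
    (List.range (k + 1)).flatMap (fun i => (List.range n).map (A (i + m))) =
      (List.range n).map (A m) ++
        (List.range k).flatMap (fun i => (List.range n).map (A (i + (m + 1)))) := by
  rw [List.range_succ_eq_map, List.flatMap_cons, List.flatMap_map]
  simp [Nat.succ_eq_add_one, Nat.add_assoc, Nat.add_comm 1]

theorem length_rowMajor (n : ℕ) (A : ℕ → ℕ → Bool) : (rowMajor n A).length = n * n := by
  simp [rowMajor, List.length_flatMap]

theorem getElem?_rowMajor {n : ℕ} (A : ℕ → ℕ → Bool) {x y : ℕ} (hx : x < n) (hy : y < n) :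
    (rowMajor n A)[x * n + y]? = some (A x y) := by
  have key : ∀ x k m : ℕ, x < k →
      ((List.range k).flatMap (fun i => (List.range n).map (A (i + m))))[x * n + y]? =
        some (A (x + m) y) := by
    intro x
    induction x with
    | zero =>
      intro k m hk
      obtain ⟨k, rfl⟩ := Nat.exists_eq_add_one.2 hk
      rw [flatMap_rows_append, List.getElem?_append_left (by simpa using hy)]
      simp [hy]
    | succ x ih =>
      intro k m hk
      obtain ⟨k, rfl⟩ := Nat.exists_eq_add_one.2 (Nat.zero_lt_of_lt hk)
      rw [flatMap_rows_append, List.getElem?_append_right (by simp; nlinarith)]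
      have e : (x + 1) * n + y - ((List.range n).map (A m)).length = x * n + y := by
        simp [Nat.add_mul]; omega
      rw [e, ih k (m + 1) (by omega), Nat.add_assoc, Nat.add_comm 1]
  simpa [rowMajor] using key x n 0 hx

/-- The stacks of the loop programs. -/
inductive Tape : Type
  /-- the unread input -/
  | inp
  /-- the output, last bit on top -/
  | out
  /-- the output, first bit on top -/
  | res
  /-- the number of vertices in unary -/
  | num
  /-- the adjacency matrix, row by row -/
  | mat
  /-- scratch -/
  | t₁
  /-- scratch -/
  | t₂
  /-- scratch -/
  | t₃
  /-- the value of a loop variable in unary -/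
  | var (i : Fin 6)
  /-- the number of iterations that remain, in unary -/
  | rem (i : Fin 6)
  deriving DecidableEq, Fintype

namespace StackProg

open Tape

/-- The memory of a loop program inside the loops for the variables `i < d`: it holds an
`n × n` matrix `A` and the values `ρ` of the variables. -/
structure Holds (n : ℕ) (A : ℕ → ℕ → Bool) (d : ℕ) (ρ : Fin 6 → ℕ) (s : Tape → List Bool) :
    Prop where
  num : s num = List.replicate n true
  mat : s mat = rowMajor n A
  t₁ : s t₁ = []
  t₂ : s t₂ = []
  t₃ : s t₃ = []
  var : ∀ i, s (var i) = List.replicate (ρ i) true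
  lt : ∀ i : Fin 6, (i : ℕ) < d → ρ i < n
  zero : ∀ i : Fin 6, d ≤ (i : ℕ) → ρ i = 0
  rem : ∀ i : Fin 6, d ≤ (i : ℕ) → s (rem i) = []

theorem Holds.le {n A d ρ s} (h : Holds n A d ρ s) (i : Fin 6) : ρ i ≤ n := by
  rcases lt_or_ge (i : ℕ) d with hi | hi
  · exact (h.lt i hi).le
  · simp [h.zero i hi]

/-- Some loop program decides `b` in polynomial time, inside the loops for the variables
`i < d`. -/
def Testable (d : ℕ) (b : ℕ → (ℕ → ℕ → Bool) → (Fin 6 → ℕ) → Bool) : Prop :=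
  ∃ (p : StackProg Tape) (T : Polynomial ℕ), ∀ n A ρ s σ, Holds n A d ρ s →
    Runs p (σ, s) (T.eval n) (some (b n A ρ), s)

/-- Some loop program outputs the word `w` in polynomial time, inside the loops for the variables
`i < d`. -/
def Emits (d : ℕ) (w : ℕ → (ℕ → ℕ → Bool) → (Fin 6 → ℕ) → List Bool) : Prop :=
  ∃ (p : StackProg Tape) (T : Polynomial ℕ), ∀ n A ρ s σ, Holds n A d ρ s →
    ∃ σ', Runs p (σ, s) (T.eval n) (σ', Function.update s out ((w n A ρ).reverse ++ s out))

section Tests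

variable {d : ℕ} {b b' : ℕ → (ℕ → ℕ → Bool) → (Fin 6 → ℕ) → Bool}

theorem Testable.not (h : Testable d b) : Testable d fun n A ρ => !(b n A ρ) := by
  obtain ⟨p, T, h⟩ := h
  refine ⟨seq p (set fun σ => some !(σ == some true)), T + 1, fun n A ρ s σ hs => ?_⟩
  have := (h n A ρ s σ hs).seq (runs_set (fun σ => some !(σ == some true)) _ s)
  simpa using this

theorem Testable.and (h : Testable d b) (h' : Testable d b') :
    Testable d fun n A ρ => b n A ρ && b' n A ρ := by
  obtain ⟨p, T, h⟩ := h
  obtain ⟨q, U, h'⟩ := h'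
  refine ⟨seq p (ite (fun σ => σ == some true) q (set id)), T + (1 + (U + 1)),
    fun n A ρ s σ hs => ?_⟩
  simp only [Polynomial.eval_add, Polynomial.eval_one]
  refine (h n A ρ s σ hs).seq (Runs.ite (fun hb => ?_) fun hb => ?_)
  · have hb : b n A ρ = true := by simpa using hb
    simpa [hb] using (h' n A ρ s (some (b n A ρ)) hs).mono (Nat.le_add_right _ 1)
  · have hb : b n A ρ = false := by simpa using hb
    simpa [hb] using (runs_set id (some (b n A ρ)) s).mono (Nat.le_add_left 1 _)

theorem Testable.or (h : Testable d b) (h' : Testable d b') :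
    Testable d fun n A ρ => b n A ρ || b' n A ρ := by
  simpa using (h.not.and h'.not).not

/-- A body that drops `r` elements of `b`, run once for each element of `k`. -/
theorem runs_forCopy_drop {K : Type} [DecidableEq K] {k t b : K} (hkt : k ≠ t) (hkb : k ≠ b)
    (htb : t ≠ b) {p : StackProg K} {T r : ℕ} (s : K → List Bool) (ht : s t = [])
    (hp : ∀ σ L l l', ∃ σ', Runs p
      (σ, Function.update (Function.update (Function.update s k l) t l') b L) T
      (σ', Function.update (Function.update (Function.update s k l) t l') b (L.drop r)))
    (σ : Option Bool) (L : List Bool) :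
    Runs (forCopy k t p) (σ, Function.update s b L) ((s k).length * (T + 6) + 4)
      (none, Function.update s b (L.drop ((s k).length * r))) := by
  have h := runs_forCopy hkt (p := p) (T := T) (fun i => Function.update s b (L.drop (i * r))) (s k)
    (by simp [hkb]) (by simp [htb, ht]) ?_ σ
  · simpa using h
  · intro i _ σ l l'
    obtain ⟨σ', h⟩ := hp σ (L.drop (i * r)) l l'
    refine ⟨σ', h.congr ?_ ?_ le_rfl⟩
    · rw [Function.update_comm htb, Function.update_comm hkb]
    · rw [Function.update_comm htb, Function.update_comm hkb, List.drop_drop,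
        Nat.add_mul, Nat.one_mul]

/-- Dropping `ρ x` bits from a stack of `ρ y` bits leaves a bit if and only if `ρ x < ρ y`. -/
theorem testable_lt (x y : Fin 6) : Testable d fun _ _ ρ => decide (ρ x < ρ y) := by
  refine ⟨test (var y) t₃ t₁ (forCopy (var x) t₁ (pop t₃)),
    Polynomial.X * 10 + (Polynomial.X * 7 + 4) + 9, fun n A ρ s σ hs => ?_⟩
  have h := runs_test (a := var y) (b := t₃) (t := t₁) (by simp) (by simp) (by simp)
    (p := forCopy (var x) t₁ (pop t₃)) (T := ρ x * 7 + 4) (m := ρ x) s hs.t₁ hs.t₃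
    (fun σ => ⟨none, ?_⟩) σ
  · rw [hs.var, List.length_replicate, List.getElem?_replicate] at h
    have e : ((if ρ x < ρ y then some true else none) == some true) = decide (ρ x < ρ y) := by
      split_ifs with hxy <;> simp [hxy]
    rw [e] at h
    refine h.mono ?_
    have := hs.le x; have := hs.le y
    simp
    omega
  · have h := runs_forCopy_drop (k := var x) (t := t₁) (b := t₃) (by simp) (by simp) (by simp)
      (p := pop t₃) (T := 1) (r := 1) s hs.t₁
      (fun σ L l l' => ⟨_, by
        simpa using runs_pop t₃ σ (Function.update (Function.update (Function.update s _ l) _ l')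
          t₃ L)⟩) σ (s (var y))
    simpa [hs.var] using h

/-- The entry `A (ρ x) (ρ y)` has the number `ρ x * n + ρ y` in the matrix, so it is found by dropping
`ρ x` rows and then `ρ y` bits. -/
theorem testable_adj (x y : Fin 6) (hx : (x : ℕ) < d) (hy : (y : ℕ) < d) :
    Testable d fun _ A ρ => A (ρ x) (ρ y) := by
  refine ⟨test mat t₃ t₁ (seq (forCopy (var x) t₁ (forCopy num t₂ (pop t₃)))
      (forCopy (var y) t₁ (pop t₃))),
    Polynomial.X * Polynomial.X * 10 +
      (Polynomial.X * (Polynomial.X * 7 + 10) + 4 + (Polynomial.X * 7 + 4)) + 9,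
    fun n A ρ s σ hs => ?_⟩
  have pop_drop : ∀ (s : Tape → List Bool) σ L, Runs (pop t₃) (σ, Function.update s t₃ L) 1
      (L.head?, Function.update s t₃ (L.drop 1)) := fun s σ L => by
    simpa using runs_pop t₃ σ (Function.update s t₃ L)
  have h := runs_test (a := mat) (b := t₃) (t := t₁) (by simp) (by simp) (by simp)
    (p := seq (forCopy (var x) t₁ (forCopy num t₂ (pop t₃))) (forCopy (var y) t₁ (pop t₃)))
    (T := n * (n * 7 + 10) + 4 + (n * 7 + 4)) (m := ρ x * n + ρ y) s hs.t₁ hs.t₃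
    (fun σ => ⟨none, ?_⟩) σ
  · rw [hs.mat, length_rowMajor, getElem?_rowMajor A (hs.lt x hx) (hs.lt y hy)] at h
    simpa using h
  · have h₁ := runs_forCopy_drop (k := var x) (t := t₁) (b := t₃) (by simp) (by simp) (by simp)
      (p := forCopy num t₂ (pop t₃)) (T := n * 7 + 4) (r := n) s hs.t₁
      (fun σ L l l' => ⟨none, by
        have := runs_forCopy_drop (k := num) (t := t₂) (b := t₃) (by simp) (by simp) (by simp)
          (p := pop t₃) (T := 1) (r := 1) (Function.update (Function.update s (var x) l) t₁ l')
          (by simp [hs.t₂]) (fun σ L l l' => ⟨_, pop_drop _ σ L⟩) σ L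
        simpa [hs.num] using this⟩) σ (s mat)
    have h₂ := runs_forCopy_drop (k := var y) (t := t₁) (b := t₃) (by simp) (by simp) (by simp)
      (p := pop t₃) (T := 1) (r := 1) s hs.t₁ (fun σ L l l' => ⟨_, pop_drop _ σ L⟩) none
      ((s mat).drop ((s (var x)).length * n))
    refine (h₁.seq h₂).congr rfl ?_ ?_
    · simp [hs.var]
    · simp only [hs.var, List.length_replicate]
      have := hs.le x; have := hs.le y
      gcongr

end Tests

section Output

variable {d : ℕ} {w w' : ℕ → (ℕ → ℕ → Bool) → (Fin 6 → ℕ) → List Bool}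

theorem emits_nil : Emits d fun _ _ _ => [] :=
  ⟨set id, 1, fun n A ρ s σ _ => ⟨σ, by simpa using runs_set id σ s⟩⟩

theorem emits_singleton (b : Bool) : Emits d fun _ _ _ => [b] :=
  ⟨push out fun _ => b, 1, fun n A ρ s σ _ => ⟨σ, by simpa using runs_push out (fun _ => b) σ s⟩⟩

theorem Holds.update_out {n A ρ s} (h : Holds n A d ρ s) (l : List Bool) :
    Holds n A d ρ (Function.update s out l) where
  num := by simp [h.num]
  mat := by simp [h.mat]
  t₁ := by simp [h.t₁]
  t₂ := by simp [h.t₂]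
  t₃ := by simp [h.t₃]
  var := by simp [h.var]
  lt := h.lt
  zero := h.zero
  rem i hi := by simp [h.rem i hi]

theorem Emits.append (h : Emits d w) (h' : Emits d w') :
    Emits d fun n A ρ => w n A ρ ++ w' n A ρ := by
  obtain ⟨p, T, h⟩ := h
  obtain ⟨q, U, h'⟩ := h'
  refine ⟨seq p q, T + U, fun n A ρ s σ hs => ?_⟩
  obtain ⟨σ₁, h₁⟩ := h n A ρ s σ hs
  obtain ⟨σ₂, h₂⟩ := h' n A ρ _ σ₁ (hs.update_out _)
  exact ⟨σ₂, (h₁.seq h₂).congr rfl (by simp) (by simp)⟩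

theorem Emits.ite {b} (hb : Testable d b) (h : Emits d w) (h' : Emits d w') :
    Emits d fun n A ρ => if b n A ρ = true then w n A ρ else w' n A ρ := by
  obtain ⟨r, V, hb⟩ := hb
  obtain ⟨p, T, h⟩ := h
  obtain ⟨q, U, h'⟩ := h'
  refine ⟨seq r (StackProg.ite (fun σ => σ == some true) p q), V + (1 + (T + U)),
    fun n A ρ s σ hs => ?_⟩
  obtain ⟨σ₁, h₁⟩ := h n A ρ s (some (b n A ρ)) hs
  obtain ⟨σ₂, h₂⟩ := h' n A ρ s (some (b n A ρ)) hs
  simp only [Polynomial.eval_add, Polynomial.eval_one]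
  refine ⟨if b n A ρ = true then σ₁ else σ₂,
    (hb n A ρ s σ hs).seq (Runs.ite (fun hb => ?_) fun hb => ?_)⟩
  · have hb : b n A ρ = true := by simpa using hb
    simpa [hb] using h₁.mono (Nat.le_add_right _ _)
  · have hb : b n A ρ = false := by simpa using hb
    simpa [hb] using h₂.mono (Nat.le_add_left _ _)

/-- A loop in which the variable number `d` takes the values `0, …, n - 1`. -/
theorem Emits.forVar (hd : d < 6) (h : Emits (d + 1) w) :
    Emits d fun n A ρ =>
      (List.range n).flatMap fun v => w n A (Function.update ρ ⟨d, hd⟩ v) := by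
  obtain ⟨p, T, h⟩ := h
  set i : Fin 6 := ⟨d, hd⟩ with hi
  refine ⟨seq (copy num (rem i) t₁) (seq (forPop (rem i) (seq p (push (var i) fun _ => true)))
    (clear (var i))), Polynomial.X * 7 + 4 + ((Polynomial.X * (T + 1 + 2) + 2) +
      (Polynomial.X * 3 + 2)), fun n A ρ s σ hs => ⟨none, ?_⟩⟩
  have hvar : s (var i) = [] := by rw [hs.var, hs.zero i le_rfl]; rfl
  have hrem : s (rem i) = [] := hs.rem i le_rfl
  have h₁ := runs_copy (a := num) (b := rem i) (t := t₁) (by simp) (by simp) (by simp) σ s hs.t₁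
  rw [hrem, List.append_nil, hs.num, List.length_replicate] at h₁
  let f : ℕ → List Bool := fun m => (List.range m).flatMap fun v => w n A (Function.update ρ i v)
  -- With the word `l` left on the counter, the variable has the value `n - l.length`.
  have h₂ := runs_forPop (k := rem i) (p := seq p (push (var i) fun _ => true))
    (T := T.eval n + 1)
    (fun l => Function.update (Function.update (Function.update s out
      ((f (n - l.length)).reverse ++ s out)) (var i)
      (List.replicate (n - l.length) true)) (rem i) l)
    (List.replicate n true) (by simp) ?_ none
  · refine (h₁.seq ((h₂.congr ?_ rfl le_rfl).seq (runs_clear (var i) _ _))).congr rfl ?_ ?_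
    · simp only [List.length_replicate, Nat.sub_self, List.replicate_zero]
      funext x
      by_cases hx : x = rem i
      · simp [hx]
      · by_cases hx' : x = var i
        · simp [hx', hvar]
        · by_cases hx'' : x = out <;> simp [hx, hx', hx'', f]
    · simp only [List.length_nil, Nat.sub_zero]
      funext x
      by_cases hx : x = rem i
      · simp [hx, hrem]
      · by_cases hx' : x = var i
        · simp [hx', hvar]
        · by_cases hx'' : x = out <;> simp [hx, hx', hx'', f]
    · simp
  · intro a l hl
    obtain ⟨l', hl'⟩ := hl
    have hn : l'.length + (l.length + 1) = n := by
      simpa using congrArg List.length hl'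
    have e₁ : n - (l.length + 1) = l'.length := by omega
    have e₂ : n - l.length = l'.length + 1 := by omega
    simp only [List.length_cons, e₁, e₂]
    set v := l'.length
    set s' := Function.update (Function.update (Function.update s out
      ((f v).reverse ++ s out)) (var i) (List.replicate v true)) (rem i) l with hs'
    have hh : Holds n A (d + 1) (Function.update ρ i v) s' := by
      refine ⟨?_, ?_, ?_, ?_, ?_, ?_, ?_, ?_, ?_⟩
      · simp [hs', hs.num]
      · simp [hs', hs.mat]
      · simp [hs', hs.t₁]
      · simp [hs', hs.t₂]
      · simp [hs', hs.t₃]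
      · intro j
        by_cases hj : j = i
        · simp [hs', hj]
        · simp [hs', hj, hs.var]
      · intro j hj
        by_cases hji : j = i
        · subst hji; simp; omega
        · rw [Function.update_of_ne hji]
          exact hs.lt j (lt_of_le_of_ne (Nat.lt_succ_iff.1 hj) fun e => hji (Fin.ext e))
      · intro j hj
        have hji : j ≠ i := fun e => by subst e; simp [hi] at hj
        rw [Function.update_of_ne hji]
        exact hs.zero j (by omega)
      · intro j hj
        have hji : j ≠ i := fun e => by subst e; simp [hi] at hj
        simp [hs', hji, hs.rem j (by omega)]
    obtain ⟨σ', h⟩ := h n A _ s' (some a) hh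
    refine ⟨σ', (h.seq (runs_push (var i) (fun _ => true) σ' _)).congr (by simp [hs']) ?_ le_rfl⟩
    have e : f (v + 1) = f v ++ w n A (Function.update ρ i v) := by
      simp [f, List.range_succ]
    funext x
    by_cases hx : x = rem i
    · simp [hx, hs']
    · by_cases hx' : x = var i
      · simp [hx', hs', List.replicate_succ]
      · by_cases hx'' : x = out <;> simp [hx, hx', hx'', hs', e]

end Output

end StackProg

/-! ### Reading a graph -/

namespace StackProg

open Tape

/-- The memory with the given stacks; all other stacks are empty. -/
def memory (input output number matrix scratch counter : List Bool) : Tape → List Bool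
  | inp => input
  | out => output
  | num => number
  | mat => matrix
  | t₃ => scratch
  | t₂ => counter
  | _ => []

/-- Read a number in unary. -/
def readNum : StackProg Tape :=
  seq (pop inp) (loop (fun σ => σ == some true) (seq (pushBit num) (pop inp)))

theorem runs_readNum (n : ℕ) (r o : List Bool) (σ) :
    Runs readNum (σ, memory (List.replicate n true ++ false :: r) o [] [] [] []) (n * 3 + 2)
      (some false, memory r o (List.replicate n true) [] [] []) := by
  have key : ∀ m k, Runs (loop (fun σ => σ == some true) (seq (pushBit num) (pop inp)))
      ((List.replicate m true ++ false :: r).head?,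
        memory (List.replicate m true ++ false :: r).tail o (List.replicate k true) [] [] [])
      (m * 3 + 1) (some false, memory r o (List.replicate (m + k) true) [] [] []) := by
    intro m
    induction m with
    | zero => exact fun k => ⟨1, by simp, by simpa using .loop_done rfl⟩
    | succ m ih =>
      intro k
      have h := (runs_push num (fun σ => σ == some true) (some true)
        (memory (List.replicate m true ++ false :: r) o (List.replicate k true) [] [] [])).seq
        (runs_pop inp _ _)
      refine (Runs.loop_step (by simp) h ((ih (k + 1)).congr ?_ ?_ le_rfl)).mono
        (by omega)
      · funext x
        cases x <;> simp [memory, List.replicate_succ]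
      · rw [Nat.add_right_comm, Nat.add_assoc]
  refine ((runs_pop inp σ _).seq ((key n 0).congr ?_ rfl le_rfl)).congr rfl rfl (by omega)
  funext x
  cases x <;> simp [memory]

/-- Read the rows of the adjacency matrix, extending each by `c` bits `true`. The rows are counted on
`t₂`, because the inner loop needs `num` intact. The result is on `t₃`, last bit on top. -/
def readRows (c : ℕ) : StackProg Tape :=
  seq (copy num t₂ t₁) (forPop t₂ (seq (forCopy num t₁ (seq (pop inp) (pushBit t₃)))
    (repeatProg c (push t₃ fun _ => true))))

/-- Increase `num` by `c` and append `c` rows of bits `true` to the matrix on `t₃`. -/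
def padRows (c : ℕ) : StackProg Tape :=
  seq (repeatProg c (push num fun _ => true))
    (repeatProg c (forCopy num t₁ (push t₃ fun _ => true)))

/-- The first `m` rows of length `w` of the matrix `A`; the square case is `rowMajor`. -/
def rows (w : ℕ) (A : ℕ → ℕ → Bool) (m : ℕ) : List Bool :=
  (List.range m).flatMap fun i => (List.range w).map (A i)

theorem rows_succ (w : ℕ) (A : ℕ → ℕ → Bool) (m : ℕ) :
    rows w A (m + 1) = rows w A m ++ (List.range w).map (A m) := by
  simp [rows, List.range_succ]

theorem reverse_map_range_succ (f : ℕ → Bool) (m : ℕ) :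
    ((List.range (m + 1)).map f).reverse = f m :: ((List.range m).map f).reverse := by
  simp [List.range_succ]

theorem runs_readRows (c n : ℕ) (A : ℕ → ℕ → Bool) (hA : ∀ i j, n ≤ j → A i j = true)
    (r o : List Bool) (σ) :
    Runs (readRows c) (σ, memory (rowMajor n A ++ r) o (List.replicate n true) [] [] [])
      (n * 7 + 4 + (n * (n * 8 + 4 + (c + 1) + 2) + 2))
      (none, memory r o (List.replicate n true) [] (rows (n + c) A n).reverse []) := by
  have h₁ := runs_copy (a := num) (b := t₂) (t := t₁) (by simp) (by simp) (by simp) σ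
    (memory (rowMajor n A ++ r) o (List.replicate n true) [] [] []) rfl
  have h₂ := runs_forPop (k := t₂) (p := seq (forCopy num t₁ (seq (pop inp) (pushBit t₃)))
    (repeatProg c (push t₃ fun _ => true))) (T := n * 8 + 4 + (c + 1))
    (fun l => memory ((rowMajor n A ++ r).drop ((n - l.length) * n)) o (List.replicate n true) []
      (rows (n + c) A (n - l.length)).reverse l) (List.replicate n true) (fun l => rfl) ?_ none
  · refine (h₁.seq (h₂.congr ?_ rfl le_rfl)).congr rfl ?_ ?_
    · funext x
      cases x <;> simp [memory, rows]
    · have e : (rowMajor n A ++ r).drop (n * n) = r := by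
        rw [← length_rowMajor n A, List.drop_left]
      simp [e]
    · simp [memory]
  · intro a l hl
    have hn : l.length < n := by simpa using hl.length_le
    set i := n - (l.length + 1) with hi
    have e₂ : n - l.length = i + 1 := by omega
    simp only [List.length_cons, e₂, ← hi]
    have hin : i < n := by omega
    have h₃ := runs_forCopy (k := num) (t := t₁) (by simp) (p := seq (pop inp) (pushBit t₃))
      (T := 2) (fun j => memory ((rowMajor n A ++ r).drop (i * n + j)) o (List.replicate n true) []
        (((List.range j).map (A i)).reverse ++ (rows (n + c) A i).reverse) l)
      (List.replicate n true) (fun j => rfl) (fun j => rfl) ?_ (some a)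
    · obtain ⟨σ', h₄⟩ := runs_repeatProg (p := push t₃ fun _ => true) (T := 1) (c := c)
        (fun k => memory ((rowMajor n A ++ r).drop (i * n + n)) o (List.replicate n true) []
        (((List.range (n + k)).map (A i)).reverse ++ (rows (n + c) A i).reverse) l)
        (fun k _ σ => ⟨σ, (runs_push t₃ _ σ _).congr rfl (by
          rw [← Nat.add_assoc, reverse_map_range_succ, hA i (n + k) (by omega)]
          funext x
          cases x <;> simp [memory]) le_rfl⟩) none
      refine ⟨σ', (h₃.seq (h₄.congr ?_ ?_ le_rfl)).congr ?_ rfl ?_⟩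
      · simp
      · rw [rows_succ, Nat.add_mul, Nat.one_mul, List.reverse_append]
      · funext x
        cases x <;> simp [memory]
      · simp
    · intro j hj σ l₁ l₂
      have hj : j < n := by simpa using hj
      have e₃ : ((rowMajor n A ++ r).drop (i * n + j)).head? = some (A i j) := by
        rw [List.head?_drop, List.getElem?_append_left, getElem?_rowMajor A hin hj]
        rw [length_rowMajor]
        nlinarith
      refine ⟨_, ((runs_pop inp σ _).seq (runs_push t₃ _ _ _)).congr rfl ?_ le_rfl⟩
      rw [reverse_map_range_succ]
      funext x
      cases x <;> simp [memory, e₃, ← Nat.add_assoc]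

theorem runs_padRows (c n : ℕ) (A : ℕ → ℕ → Bool) (hA : ∀ i j, n ≤ i → A i j = true)
    (r o : List Bool) (σ) : ∃ σ',
    Runs (padRows c) (σ, memory r o (List.replicate n true) [] (rows (n + c) A n).reverse [])
      (c + 1 + (c * ((n + c) * 7 + 4) + 1))
      (σ', memory r o (List.replicate (n + c) true) [] (rowMajor (n + c) A).reverse []) := by
  obtain ⟨σ₁, h₁⟩ := runs_repeatProg (p := push num fun _ => true) (T := 1) (c := c)
    (fun k => memory r o (List.replicate (n + k) true) [] (rows (n + c) A n).reverse [])
    (fun k _ σ => ⟨σ, (runs_push num _ σ _).congr rfl (by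
      rw [← Nat.add_assoc, List.replicate_succ]
      funext x
      cases x <;> simp [memory]) le_rfl⟩) σ
  obtain ⟨σ₂, h₂⟩ := runs_repeatProg (p := forCopy num t₁ (push t₃ fun _ => true))
    (T := (n + c) * 7 + 4) (c := c)
    (fun k => memory r o (List.replicate (n + c) true) [] (rows (n + c) A (n + k)).reverse [])
    (fun k _ σ => by
      have h₃ := runs_forCopy (k := num) (t := t₁) (by simp) (p := push t₃ fun _ => true)
        (T := 1) (fun j => memory r o (List.replicate (n + c) true) []
          (((List.range j).map (A (n + k))).reverse ++ (rows (n + c) A (n + k)).reverse) [])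
        (List.replicate (n + c) true) (fun j => rfl) (fun j => rfl)
        (fun j _ σ l₁ l₂ => ⟨σ, (runs_push t₃ _ σ _).congr rfl (by
          rw [reverse_map_range_succ, hA (n + k) j (by omega)]
          funext x
          cases x <;> simp [memory]) le_rfl⟩) σ
      refine ⟨none, h₃.congr (by simp) ?_ (by simp)⟩
      rw [← Nat.add_assoc, rows_succ]
      simp) σ₁
  exact ⟨σ₂, (h₁.seq h₂).congr rfl rfl (by simp)⟩

/-- Read a graph and add `c` universal vertices to it. -/
def load (c : ℕ) : StackProg Tape :=
  seq readNum (seq (readRows c) (seq (padRows c) (move t₃ mat)))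

/-- The matrix `A` is read up to the index `n` and extended by `true`, that is, by universal vertices.
Its diagonal is irrelevant. -/
theorem exists_runs_load (c : ℕ) : ∃ T : Polynomial ℕ, ∀ (n : ℕ) (A : ℕ → ℕ → Bool),
    (∀ i j, n ≤ i ∨ n ≤ j → A i j = true) → ∀ (r o : List Bool) (σ),
    Runs (load c) (σ, memory (List.replicate n true ++ false :: (rowMajor n A ++ r)) o [] [] [] [])
      (T.eval n)
      (none, memory r o (List.replicate (n + c) true) (rowMajor (n + c) A) [] []) := by
  refine ⟨.X * 3 + 2 + ((.X * 7 + 4 + (.X * (.X * 8 + 4 + ((c : Polynomial ℕ) + 1) + 2) + 2)) +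
    (((c : Polynomial ℕ) + 1 + ((c : Polynomial ℕ) * ((.X + (c : Polynomial ℕ)) * 7 + 4) + 1)) +
    ((.X + (c : Polynomial ℕ)) * (.X + (c : Polynomial ℕ)) * 3 + 2))),
    fun n A hA r o σ => ?_⟩
  obtain ⟨σ', h⟩ := runs_padRows c n A (fun i j h => hA i j (.inl h)) r o none
  refine ((runs_readNum n _ o σ).seq
    ((runs_readRows c n A (fun i j h => hA i j (.inr h)) r o _).seq
      (h.seq (runs_move (by simp) σ' _)))).congr rfl ?_ ?_
  · funext x
    cases x <;> simp [memory]
  · simp [memory, length_rowMajor]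

/-- A program that reads a graph, adds `c` universal vertices and outputs the word `w` of the
result, on top of what the output stack already holds. -/
theorem Emits.exists_runs {w : ℕ → (ℕ → ℕ → Bool) → (Fin 6 → ℕ) → List Bool} (hw : Emits 0 w)
    (c : ℕ) : ∃ (p : StackProg Tape) (T : Polynomial ℕ), ∀ (n : ℕ) (A : ℕ → ℕ → Bool),
    (∀ i j, n ≤ i ∨ n ≤ j → A i j = true) → ∀ (r o : List Bool) (σ),
    Runs p (σ, memory (List.replicate n true ++ false :: (rowMajor n A ++ r)) o [] [] [] [])
      (T.eval n) (none, memory r ((w (n + c) A 0).reverse ++ o) [] [] [] []) := by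
  obtain ⟨T, h⟩ := exists_runs_load c
  obtain ⟨p, U, hp⟩ := hw
  refine ⟨seq (load c) (seq p (seq (clear num) (clear mat))),
    T + (U.comp (.X + (c : Polynomial ℕ)) + (((.X + (c : Polynomial ℕ)) * 3 + 2) +
      ((.X + (c : Polynomial ℕ)) * (.X + (c : Polynomial ℕ)) * 3 + 2))), fun n A hA r o σ => ?_⟩
  have hh : Holds (n + c) A 0 0
      (memory r o (List.replicate (n + c) true) (rowMajor (n + c) A) [] []) := by
    refine ⟨rfl, rfl, rfl, rfl, rfl, fun i => rfl, fun i hi => by simp at hi, fun i _ => rfl,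
      fun i _ => rfl⟩
  obtain ⟨σ', h'⟩ := hp (n + c) A 0 _ none hh
  refine ((h n A hA r o σ).seq (h'.seq ((runs_clear num σ' _).seq (runs_clear mat _ _)))).congr
    rfl ?_ ?_
  · funext x
    cases x <;> simp [memory]
  · simp [memory, length_rowMajor]

end StackProg

/-! ### Adjacency in the constructed graph -/

section PrimeGraph

variable {V W : Type*} {G : SimpleGraph V} {H : SimpleGraph W}

theorem subdivideOnce_adj_inl_inr (v : V) (e : G.edgeSet) :
    (subdivideOnce G).Adj (.inl v) (.inr e) ↔ v ∈ (e : Sym2 V) := by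
  simp [subdivideOnce]

theorem subdivideOnce_adj_inr_inl (v : V) (e : G.edgeSet) :
    (subdivideOnce G).Adj (.inr e) (.inl v) ↔ v ∈ (e : Sym2 V) := by
  simp [subdivideOnce]

theorem not_subdivideOnce_adj_inl_inl (u v : V) :
    ¬ (subdivideOnce G).Adj (.inl u) (.inl v) := by
  simp [subdivideOnce]

theorem not_subdivideOnce_adj_inr_inr (e f : G.edgeSet) :
    ¬ (subdivideOnce G).Adj (.inr e) (.inr f) := by
  simp [subdivideOnce]

/-- The edges of `subdivideOnce G` are the halves of the edges of `G`; the half at `d.fst` belongs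
to the dart `d`. -/
def halfEdge (d : G.Dart) : (subdivideOnce G).edgeSet :=
  ⟨s(.inl d.fst, .inr ⟨d.edge, d.edge_mem⟩), by
    simp [subdivideOnce_adj_inl_inr, SimpleGraph.Dart.edge, Sym2.mem_iff]⟩

theorem inl_mem_halfEdge {v : V} {d : G.Dart} :
    (Sum.inl v : V ⊕ G.edgeSet) ∈ (halfEdge d : Sym2 (V ⊕ G.edgeSet)) ↔ v = d.fst := by
  simp [halfEdge]

theorem inr_mem_halfEdge {e : G.edgeSet} {d : G.Dart} :
    (Sum.inr e : V ⊕ G.edgeSet) ∈ (halfEdge d : Sym2 (V ⊕ G.edgeSet)) ↔ (e : Sym2 V) = d.edge := by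
  simp [halfEdge, Subtype.ext_iff]

theorem halfEdge_bijective : Function.Bijective (halfEdge (G := G)) := by
  constructor
  · intro d d' h
    have h₁ : d.fst = d'.fst := inl_mem_halfEdge.1 (h ▸ inl_mem_halfEdge.2 rfl)
    have h₂ : d.edge = d'.edge :=
      inr_mem_halfEdge.1 (h ▸ inr_mem_halfEdge (e := ⟨d.edge, d.edge_mem⟩).2 rfl)
    rcases (SimpleGraph.dart_edge_eq_iff d d').1 h₂ with h | h
    · exact h
    · subst h
      exact absurd h₁.symm d'.fst_ne_snd
  · rintro ⟨x, hx⟩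
    induction x with
    | h p q =>
      rw [SimpleGraph.mem_edgeSet] at hx
      have key : ∀ v (e : G.edgeSet), v ∈ (e : Sym2 V) →
          ∃ d : G.Dart, (halfEdge d : Sym2 (V ⊕ G.edgeSet)) = s(.inl v, .inr e) := by
        rintro v ⟨e, he⟩ hv
        obtain ⟨w, rfl⟩ := Sym2.mem_iff_exists.1 hv
        exact ⟨⟨(v, w), he⟩, rfl⟩
      rcases p with v | e <;> rcases q with w | f
      · exact (not_subdivideOnce_adj_inl_inl _ _ hx).elim
      · obtain ⟨d, hd⟩ := key v f ((subdivideOnce_adj_inl_inr _ _).1 hx)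
        exact ⟨d, Subtype.ext hd⟩
      · obtain ⟨d, hd⟩ := key w e ((subdivideOnce_adj_inr_inl _ _).1 hx)
        exact ⟨d, Subtype.ext (hd.trans Sym2.eq_swap)⟩
      · exact (not_subdivideOnce_adj_inr_inr _ _ hx).elim

/-- The vertex of `G'` for a vertex of `G`. -/
abbrev vertexPoint (v : V) : PrimeVertex G := .inl (.inl v)

/-- The vertex of `G'` for an edge of `G`. -/
abbrev edgePoint (e : G.edgeSet) : PrimeVertex G := .inl (.inr e)

/-- The vertex of `G'` for a dart of `G`. -/
abbrev dartPoint (d : G.Dart) : PrimeVertex G := .inr (halfEdge d)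

/-- The vertices of `G'` correspond to the vertices, the edges and the darts of `G`. -/
theorem PrimeVertex.cases {p : PrimeVertex G → Prop} (vertex : ∀ v, p (vertexPoint v))
    (edge : ∀ e, p (edgePoint e)) (dart : ∀ d, p (dartPoint d)) (x : PrimeVertex G) : p x := by
  rcases x with (v | e) | x
  · exact vertex v
  · exact edge e
  · obtain ⟨d, rfl⟩ := halfEdge_bijective.2 x
    exact dart d

theorem primeGraph_adj_vertex_vertex {u v : V} :
    (primeGraph G).Adj (vertexPoint u) (vertexPoint v) ↔ u ≠ v := by
  simp [primeGraph, joinOriginalFirst, not_subdivideOnce_adj_inl_inl]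

theorem not_primeGraph_adj_vertex_edge {v : V} {e : G.edgeSet} :
    ¬ (primeGraph G).Adj (vertexPoint v) (edgePoint e) := by
  simp [primeGraph, joinOriginalFirst]

theorem primeGraph_adj_edge_edge {e f : G.edgeSet} :
    (primeGraph G).Adj (edgePoint e) (edgePoint f) ↔ e ≠ f := by
  simp [primeGraph, joinOriginalFirst, not_subdivideOnce_adj_inl_inl]

theorem primeGraph_adj_vertex_dart {v : V} {d : G.Dart} :
    (primeGraph G).Adj (vertexPoint v) (dartPoint d) ↔ v ≠ d.fst := by
  simp [primeGraph, joinOriginalFirst, subdivideOnce_adj_inl_inr, inl_mem_halfEdge]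

theorem primeGraph_adj_edge_dart {e : G.edgeSet} {d : G.Dart} :
    (primeGraph G).Adj (edgePoint e) (dartPoint d) ↔ (e : Sym2 V) ≠ d.edge := by
  simp [primeGraph, joinOriginalFirst, subdivideOnce_adj_inl_inr, inr_mem_halfEdge]

theorem primeGraph_adj_dart_dart {d d' : G.Dart} :
    (primeGraph G).Adj (dartPoint d) (dartPoint d') ↔ d ≠ d' := by
  simp [primeGraph, joinOriginalFirst, not_subdivideOnce_adj_inr_inr, halfEdge_bijective.1.eq_iff]

/-- Isomorphic graphs have isomorphic subdivisions. -/
def subdivideOnceIso (φ : G ≃g H) : subdivideOnce G ≃g subdivideOnce H where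
  toEquiv := Equiv.sumCongr φ.toEquiv φ.mapEdgeSet
  map_rel_iff' := by
    rintro (u | e) (v | f)
    · simp [not_subdivideOnce_adj_inl_inl]
    · obtain ⟨f, hf⟩ := f
      simp [subdivideOnce_adj_inl_inr, SimpleGraph.Iso.mapEdgeSet]
    · obtain ⟨e, he⟩ := e
      simp [subdivideOnce_adj_inr_inl, SimpleGraph.Iso.mapEdgeSet]
    · simp [not_subdivideOnce_adj_inr_inr]

/-- Isomorphic graphs `G`, `H` have isomorphic graphs `G'`, `H'`. -/
def primeGraphIso (φ : G ≃g H) : primeGraph G ≃g primeGraph H where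
  toEquiv := (subdivideOnceIso (subdivideOnceIso φ)).toEquiv
  map_rel_iff' := by
    intro x y
    have h₁ := (subdivideOnceIso (subdivideOnceIso φ)).map_adj_iff (v := x) (w := y)
    have h₂ : (joinOriginalFirst H).Adj (subdivideOnceIso (subdivideOnceIso φ) x)
        (subdivideOnceIso (subdivideOnceIso φ) y) ↔ (joinOriginalFirst G).Adj x y := by
      rcases x with (u | e) | x <;> rcases y with (v | f) | y <;>
        simp [joinOriginalFirst, subdivideOnceIso]
    simp only [primeGraph, SimpleGraph.compl_adj, SimpleGraph.sup_adj]
    exact and_congr (not_congr (Equiv.apply_eq_iff_eq _)) (not_congr (or_congr h₁ h₂))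

end PrimeGraph

/-! ### Recovering a graph of minimum degree three -/

namespace SimpleGraph

variable {α β : Type*}

/-- At least three vertices with property `p` are different from `x` and not adjacent to `x`. -/
def ThreeNonadj (A : SimpleGraph α) (p : α → Prop) (x : α) : Prop :=
  ∃ a b c, a ≠ b ∧ a ≠ c ∧ b ≠ c ∧ ∀ y, y = a ∨ y = b ∨ y = c → p y ∧ y ≠ x ∧ ¬ A.Adj x y

/-- The intrinsic description of the vertices of `G'` that stand for vertices or edges of `G`. -/
def IsBig (A : SimpleGraph α) (x : α) : Prop :=
  A.ThreeNonadj (fun _ => True) x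

/-- The intrinsic description of the vertices of `G'` that stand for vertices of `G`, among those
that stand for vertices or edges. -/
def IsFull (A : SimpleGraph α) (x : α) : Prop :=
  A.ThreeNonadj (fun y => ¬ A.IsBig y) x

/-- The intrinsic description, in `G'`, of the adjacency of two vertices of `G`: both are ends of
one edge. -/
def Linked (A : SimpleGraph α) (x x' : α) : Prop :=
  x ≠ x' ∧ ∃ y d d', A.IsBig y ∧ ¬ A.IsFull y ∧ ¬ A.IsBig d ∧ ¬ A.IsBig d' ∧
    ¬ A.Adj x d ∧ ¬ A.Adj y d ∧ ¬ A.Adj x' d' ∧ ¬ A.Adj y d'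

variable {A : SimpleGraph α} {B : SimpleGraph β}

theorem ThreeNonadj.map (ψ : A ≃g B) {p : α → Prop} {q : β → Prop} (hpq : ∀ x, p x → q (ψ x))
    {x : α} (h : A.ThreeNonadj p x) : B.ThreeNonadj q (ψ x) := by
  obtain ⟨a, b, c, hab, hac, hbc, h⟩ := h
  refine ⟨ψ a, ψ b, ψ c, by simpa, by simpa, by simpa, ?_⟩
  intro y hy
  obtain ⟨y, rfl⟩ := ψ.surjective y
  obtain ⟨h₁, h₂, h₃⟩ := h y (by simpa using hy)
  exact ⟨hpq y h₁, by simpa, by simpa [ψ.map_adj_iff]⟩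

theorem isBig_iso (ψ : A ≃g B) (x : α) : B.IsBig (ψ x) ↔ A.IsBig x :=
  ⟨fun h => by
    simpa [IsBig] using ThreeNonadj.map ψ.symm (q := fun _ => True) (fun _ h => h) h,
    fun h => ThreeNonadj.map ψ (fun _ h => h) h⟩

theorem isFull_iso (ψ : A ≃g B) (x : α) : B.IsFull (ψ x) ↔ A.IsFull x := by
  refine ⟨fun h => ?_, fun h => h.map ψ fun y hy => by rwa [isBig_iso]⟩
  have := ThreeNonadj.map ψ.symm (q := fun y => ¬ A.IsBig y)
    (fun y hy => by rwa [isBig_iso ψ.symm]) h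
  simpa [IsFull] using this

theorem linked_iso (ψ : A ≃g B) (x x' : α) : B.Linked (ψ x) (ψ x') ↔ A.Linked x x' := by
  simp only [Linked, ψ.surjective.exists, isBig_iso, isFull_iso, ψ.map_adj_iff, ne_eq,
    EmbeddingLike.apply_eq_iff_eq]

end SimpleGraph

section Reconstruction

variable {V W : Type*} {G : SimpleGraph V} {H : SimpleGraph W}

/-- The only non-neighbors of a dart are the vertex where it starts and its edge. -/
theorem not_isBig_dartPoint (d : G.Dart) : ¬ (primeGraph G).IsBig (dartPoint d) := by
  rintro ⟨a, b, c, hab, hac, hbc, h⟩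
  have key : ∀ y : PrimeVertex G, y = a ∨ y = b ∨ y = c →
      y = vertexPoint d.fst ∨ y = edgePoint ⟨d.edge, d.edge_mem⟩ := by
    intro y hy
    obtain ⟨-, h₂, h₃⟩ := h y hy
    rw [SimpleGraph.adj_comm] at h₃
    induction y using PrimeVertex.cases with
    | vertex v => rw [primeGraph_adj_vertex_dart, not_not] at h₃; exact .inl (h₃ ▸ rfl)
    | edge e =>
      rw [primeGraph_adj_edge_dart, not_not] at h₃
      exact .inr (congrArg _ (Subtype.ext h₃))
    | dart d' =>
      rw [primeGraph_adj_dart_dart, not_not] at h₃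
      exact (h₂ (h₃ ▸ rfl)).elim
  rcases key a (by simp) with ha | ha <;> rcases key b (by simp) with hb | hb <;>
    rcases key c (by simp) with hc | hc <;> simp_all

/-- A vertex is not adjacent to the darts that start there. -/
theorem isFull_vertexPoint (v : V) {a b c : V} (hab : a ≠ b) (hac : a ≠ c) (hbc : b ≠ c)
    (ha : G.Adj v a) (hb : G.Adj v b) (hc : G.Adj v c) :
    (primeGraph G).IsFull (vertexPoint v) := by
  refine ⟨dartPoint ⟨(v, a), ha⟩, dartPoint ⟨(v, b), hb⟩, dartPoint ⟨(v, c), hc⟩,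
    by simpa [halfEdge_bijective.1.eq_iff], by simpa [halfEdge_bijective.1.eq_iff], by simpa [halfEdge_bijective.1.eq_iff], ?_⟩
  rintro y (rfl | rfl | rfl) <;>
    exact ⟨not_isBig_dartPoint _, by simp, by simp [primeGraph_adj_vertex_dart]⟩

theorem isBig_vertexPoint (v : V) {a b c : V} (hab : a ≠ b) (hac : a ≠ c) (hbc : b ≠ c)
    (ha : G.Adj v a) (hb : G.Adj v b) (hc : G.Adj v c) :
    (primeGraph G).IsBig (vertexPoint v) := by
  obtain ⟨x, y, z, h₁, h₂, h₃, h⟩ := isFull_vertexPoint v hab hac hbc ha hb hc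
  exact ⟨x, y, z, h₁, h₂, h₃, fun w hw => ⟨trivial, (h w hw).2⟩⟩

/-- An edge is not adjacent to any vertex. -/
theorem isBig_edgePoint (e : G.edgeSet) {a b c : V} (hab : a ≠ b) (hac : a ≠ c) (hbc : b ≠ c) :
    (primeGraph G).IsBig (edgePoint e) := by
  refine ⟨vertexPoint a, vertexPoint b, vertexPoint c, by simpa, by simpa, by simpa, ?_⟩
  rintro y (rfl | rfl | rfl) <;>
    exact ⟨trivial, by simp, fun h => not_primeGraph_adj_vertex_edge h.symm⟩

/-- Only the two darts of an edge `e` stand for vertices of `G'` that are neither big nor adjacent to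
`e`. -/
theorem not_isFull_edgePoint (hV : ∀ v, (primeGraph G).IsBig (vertexPoint v))
    (hE : ∀ e, (primeGraph G).IsBig (edgePoint (G := G) e)) (e : G.edgeSet) :
    ¬ (primeGraph G).IsFull (edgePoint e) := by
  rintro ⟨a, b, c, hab, hac, hbc, h⟩
  obtain ⟨⟨u, v⟩, huv⟩ := e
  have key : ∀ y : PrimeVertex G, y = a ∨ y = b ∨ y = c →
      y = dartPoint ⟨(u, v), huv⟩ ∨ y = dartPoint (SimpleGraph.Dart.symm ⟨(u, v), huv⟩) := by
    intro y hy
    obtain ⟨h₁, h₂, h₃⟩ := h y hy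
    induction y using PrimeVertex.cases with
    | vertex v => exact (h₁ (hV v)).elim
    | edge e => exact (h₁ (hE e)).elim
    | dart d =>
      rw [primeGraph_adj_edge_dart, not_not] at h₃
      rcases (SimpleGraph.dart_edge_eq_iff d ⟨(u, v), huv⟩).1 h₃.symm with rfl | rfl
      · exact .inl rfl
      · exact .inr rfl
  rcases key a (by simp) with ha | ha <;> rcases key b (by simp) with hb | hb <;>
    rcases key c (by simp) with hc | hc <;> simp_all

/-- All that is used of minimum degree three: every vertex has three neighbors. -/
def ThreeNeighbors (G : SimpleGraph V) : Prop :=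
  ∀ v, ∃ a b c, a ≠ b ∧ a ≠ c ∧ b ≠ c ∧ G.Adj v a ∧ G.Adj v b ∧ G.Adj v c

theorem ThreeNeighbors.isFull_vertex (hG : ThreeNeighbors G) (v : V) :
    (primeGraph G).IsFull (vertexPoint v) :=
  let ⟨_, _, _, h₁, h₂, h₃, h₄, h₅, h₆⟩ := hG v
  isFull_vertexPoint v h₁ h₂ h₃ h₄ h₅ h₆

theorem ThreeNeighbors.isBig_vertex (hG : ThreeNeighbors G) (v : V) :
    (primeGraph G).IsBig (vertexPoint v) :=
  let ⟨_, _, _, h₁, h₂, h₃, h₄, h₅, h₆⟩ := hG v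
  isBig_vertexPoint v h₁ h₂ h₃ h₄ h₅ h₆

theorem ThreeNeighbors.isBig_edge (hG : ThreeNeighbors G) (e : G.edgeSet) :
    (primeGraph G).IsBig (edgePoint e) :=
  let ⟨_, _, _, h₁, h₂, h₃, _⟩ := hG (Quot.out (e : Sym2 V)).1
  isBig_edgePoint e h₁ h₂ h₃

/-- The vertices of `G` have an intrinsic description in `G'`. -/
theorem ThreeNeighbors.exists_vertexPoint_iff (hG : ThreeNeighbors G) (x : PrimeVertex G) :
    (∃ v, x = vertexPoint v) ↔ (primeGraph G).IsBig x ∧ (primeGraph G).IsFull x := by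
  constructor
  · rintro ⟨v, rfl⟩
    exact ⟨hG.isBig_vertex v, hG.isFull_vertex v⟩
  · rintro ⟨h₁, h₂⟩
    induction x using PrimeVertex.cases with
    | vertex v => exact ⟨v, rfl⟩
    | edge e => exact (not_isFull_edgePoint hG.isBig_vertex hG.isBig_edge e h₂).elim
    | dart d => exact (not_isBig_dartPoint d h₁).elim

/-- The adjacency of `G` has an intrinsic description in `G'`. -/
theorem ThreeNeighbors.linked_iff (hG : ThreeNeighbors G) (u v : V) :
    (primeGraph G).Linked (vertexPoint u) (vertexPoint v) ↔ G.Adj u v := by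
  constructor
  · rintro ⟨huv, y, x, x', hy, hy', hx, hx', h₁, h₂, h₃, h₄⟩
    induction y using PrimeVertex.cases with
    | vertex w => exact (hy' (hG.isFull_vertex w)).elim
    | dart d => exact (not_isBig_dartPoint d hy).elim
    | edge e =>
    induction x using PrimeVertex.cases with
    | vertex w => exact (hx (hG.isBig_vertex w)).elim
    | edge e => exact (hx (hG.isBig_edge e)).elim
    | dart d =>
    induction x' using PrimeVertex.cases with
    | vertex w => exact (hx' (hG.isBig_vertex w)).elim
    | edge e => exact (hx' (hG.isBig_edge e)).elim
    | dart d' =>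
    rw [primeGraph_adj_vertex_dart, not_not] at h₁ h₃
    rw [primeGraph_adj_edge_dart, not_not] at h₂ h₄
    rcases (SimpleGraph.dart_edge_eq_iff d d').1 (h₂.symm.trans h₄) with rfl | rfl
    · exact (huv (by rw [h₁, h₃])).elim
    · rw [h₁, h₃]
      exact d'.adj.symm
  · intro h
    refine ⟨by simpa using h.ne, edgePoint ⟨s(u, v), h⟩, dartPoint ⟨(u, v), h⟩,
      dartPoint ⟨(v, u), h.symm⟩, hG.isBig_edge _,
      not_isFull_edgePoint hG.isBig_vertex hG.isBig_edge _, not_isBig_dartPoint _,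
      not_isBig_dartPoint _, ?_, ?_, ?_, ?_⟩
    · simp [primeGraph_adj_vertex_dart]
    · simp [primeGraph_adj_edge_dart]
    · simp [primeGraph_adj_vertex_dart]
    · simp [primeGraph_adj_edge_dart, Sym2.eq_swap]

/-- An isomorphism `G' ≃g H'` maps vertices to vertices and so induces an isomorphism `G ≃g H`. -/
theorem ThreeNeighbors.nonempty_iso (hG : ThreeNeighbors G) (hH : ThreeNeighbors H)
    (ψ : primeGraph G ≃g primeGraph H) : Nonempty (G ≃g H) := by
  have h₁ : ∀ v, ∃ w, ψ (vertexPoint v) = vertexPoint w := fun v => by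
    rw [hH.exists_vertexPoint_iff, SimpleGraph.isBig_iso, SimpleGraph.isFull_iso]
    exact (hG.exists_vertexPoint_iff _).1 ⟨v, rfl⟩
  have h₂ : ∀ w, ∃ v, ψ.symm (vertexPoint w) = vertexPoint v := fun w => by
    rw [hG.exists_vertexPoint_iff, SimpleGraph.isBig_iso, SimpleGraph.isFull_iso]
    exact (hH.exists_vertexPoint_iff _).1 ⟨w, rfl⟩
  choose f hf using h₁
  choose g hg using h₂
  refine ⟨⟨⟨f, g, fun v => ?_, fun w => ?_⟩, ?_⟩⟩
  · have : vertexPoint (G := G) (g (f v)) = vertexPoint v := by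
      rw [← hg, ← hf, ψ.symm_apply_apply]
    simpa using this
  · have : vertexPoint (G := H) (f (g w)) = vertexPoint w := by
      rw [← hf, ← hg, ψ.apply_symm_apply]
    simpa using this
  · intro u v
    change H.Adj (f u) (f v) ↔ G.Adj u v
    rw [← hH.linked_iff, ← hG.linked_iff, ← hf, ← hf, SimpleGraph.linked_iso]

theorem threeNeighbors_of_degree [Fintype V] [DecidableRel G.Adj] (h : ∀ v, 3 ≤ G.degree v) :
    ThreeNeighbors G := by
  intro v
  obtain ⟨a, b, c, ha, hb, hc, h₁, h₂, h₃⟩ := Finset.two_lt_card_iff.1 (h v)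
  simp only [SimpleGraph.mem_neighborFinset] at ha hb hc
  exact ⟨a, b, c, h₁, h₂, h₃, ha, hb, hc⟩

end Reconstruction

/-! ### Universal vertices -/

/-- The graph obtained from `G` by adding a vertex that is adjacent to all others. -/
def addUniversal {V : Type*} (G : SimpleGraph V) : SimpleGraph (Option V) where
  Adj x y := x ≠ y ∧ ∀ u ∈ x, ∀ v ∈ y, G.Adj u v
  symm := ⟨fun _ _ h => ⟨h.1.symm, fun u hu v hv => (h.2 v hv u hu).symm⟩⟩
  loopless := ⟨fun _ h => h.1 rfl⟩

/-- The graph obtained from a graph on `Fin n` by adding `c` universal vertices, with the last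
numbers. -/
def pad {n : ℕ} (c : ℕ) (G : SimpleGraph (Fin n)) : SimpleGraph (Fin (n + c)) where
  Adj i j := i ≠ j ∧ ∀ (hi : (i : ℕ) < n) (hj : (j : ℕ) < n), G.Adj ⟨i, hi⟩ ⟨j, hj⟩
  symm := ⟨fun _ _ h => ⟨h.1.symm, fun hi hj => (h.2 hj hi).symm⟩⟩
  loopless := ⟨fun _ h => h.1 rfl⟩

section Universal

variable {V W : Type*} {G : SimpleGraph V} {H : SimpleGraph W}

theorem addUniversal_adj_some_some {u v : V} :
    (addUniversal G).Adj (some u) (some v) ↔ G.Adj u v := by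
  simpa [addUniversal] using fun h : G.Adj u v => h.ne

theorem addUniversal_adj_none {x : Option V} : (addUniversal G).Adj none x ↔ none ≠ x := by
  simp [addUniversal]

/-- A universal vertex can be cancelled: if the isomorphism does not match the two added vertices,
their partners are universal as well and can be matched with each other. -/
theorem nonempty_iso_of_addUniversal (φ : addUniversal G ≃g addUniversal H) :
    Nonempty (G ≃g H) := by
  refine ⟨⟨Equiv.removeNone φ.toEquiv, ?_⟩⟩
  have univ : ∀ u, φ (some u) = none → ∀ v, G.Adj u v ↔ u ≠ v := fun u hu v => by
    rw [← addUniversal_adj_some_some, ← φ.map_adj_iff, hu, addUniversal_adj_none, ← hu]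
    simp
  have univ' : ∀ h, φ none = some h → ∀ w, H.Adj h w ↔ h ≠ w := fun h hh w => by
    obtain ⟨x, hx⟩ := φ.surjective (some w)
    rw [← addUniversal_adj_some_some, ← hh, ← hx, φ.map_adj_iff, addUniversal_adj_none]
    rw [← Option.some_injective _ |>.ne_iff (x := h), ← hh, ← hx]
    simp
  have some_or : ∀ u, (∃ w, φ (some u) = some w ∧ Equiv.removeNone φ.toEquiv u = w) ∨
      (φ (some u) = none ∧ ∃ h, φ none = some h ∧ Equiv.removeNone φ.toEquiv u = h) := fun u => by
    rcases hu : φ (some u) with _ | w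
    · refine .inr ⟨rfl, Equiv.removeNone φ.toEquiv u, ?_, rfl⟩
      exact (Equiv.removeNone_none φ.toEquiv hu).symm
    · refine .inl ⟨w, rfl, ?_⟩
      have := Equiv.removeNone_some φ.toEquiv ⟨w, hu⟩
      exact Option.some_injective _ (this.trans hu)
  intro u v
  have hne : u ≠ v ↔ Equiv.removeNone φ.toEquiv u ≠ Equiv.removeNone φ.toEquiv v := by simp
  rcases some_or u with ⟨w, hw, hw'⟩ | ⟨hu, h, hh, hu'⟩
  · rcases some_or v with ⟨x, hx, hx'⟩ | ⟨hv, h, hh, hv'⟩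
    · rw [hw', hx', ← addUniversal_adj_some_some, ← hw, ← hx, φ.map_adj_iff,
        addUniversal_adj_some_some]
    · rw [H.adj_comm, G.adj_comm, univ v hv, hv', univ' h hh, ne_comm, ne_comm (a := v), hne, hv']
  · rw [univ u hu, hu', univ' h hh, hne, hu']

/-- Isomorphic graphs remain isomorphic when a universal vertex is added to both. -/
def addUniversalIso (φ : G ≃g H) : addUniversal G ≃g addUniversal H where
  toEquiv := φ.toEquiv.optionCongr
  map_rel_iff' := by
    rintro (_ | u) (_ | v)
    · simp
    · simp [addUniversal_adj_none]
    · simp [SimpleGraph.adj_comm _ _ none, addUniversal_adj_none]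
    · simpa [addUniversal_adj_some_some] using φ.map_adj_iff

/-- Without new vertices, nothing changes. -/
def padZeroIso {n : ℕ} (G : SimpleGraph (Fin n)) : pad 0 G ≃g G where
  toEquiv := Equiv.refl _
  map_rel_iff' := by
    intro i j
    exact ⟨fun h => ⟨fun e => G.loopless.irrefl i (e ▸ h), fun _ _ => h⟩,
      fun h => h.2 i.2 j.2⟩

/-- The last universal vertex is added to a graph that has all the others. -/
def padSuccIso {n : ℕ} (c : ℕ) (G : SimpleGraph (Fin n)) :
    addUniversal (pad c G) ≃g pad (c + 1) G where
  toEquiv := finSuccEquivLast.symm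
  map_rel_iff' := by
    rintro (_ | i) (_ | j)
    · simp
    · simp [addUniversal_adj_none, pad, Fin.ext_iff]
      omega
    · simp [SimpleGraph.adj_comm _ _ none, addUniversal_adj_none, pad, Fin.ext_iff]
      omega
    · simp [addUniversal_adj_some_some, pad, Fin.ext_iff]

theorem nonempty_pad_iso_iff {m n : ℕ} (c : ℕ) (G : SimpleGraph (Fin m))
    (H : SimpleGraph (Fin n)) : Nonempty (pad c G ≃g pad c H) ↔ Nonempty (G ≃g H) := by
  induction c with
  | zero =>
    exact ⟨fun ⟨φ⟩ => ⟨((padZeroIso G).symm.trans φ).trans (padZeroIso H)⟩,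
      fun ⟨φ⟩ => ⟨((padZeroIso G).trans φ).trans (padZeroIso H).symm⟩⟩
  | succ c ih =>
    rw [← ih]
    exact ⟨fun ⟨φ⟩ => nonempty_iso_of_addUniversal
        (((padSuccIso c G).trans φ).trans (padSuccIso c H).symm),
      fun ⟨φ⟩ => ⟨((padSuccIso c G).symm.trans (addUniversalIso φ)).trans (padSuccIso c H)⟩⟩

/-- Of four universal vertices, three are different from a given vertex. -/
theorem threeNeighbors_pad {n : ℕ} (G : SimpleGraph (Fin n)) : ThreeNeighbors (pad 4 G) := by
  intro v
  have key : ∀ k : Fin 4, ∃ w : Fin (n + 4), (w : ℕ) = n + k ∧ (v ≠ w → (pad 4 G).Adj v w) :=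
    fun k => ⟨⟨n + k, by omega⟩, rfl, fun h => ⟨h, fun _ hj => by simp at hj⟩⟩
  choose f hf hf' using key
  have hne : ∀ k l : Fin 4, k ≠ l → f k ≠ f l := fun k l hkl e => by
    have := congrArg Fin.val e
    rw [hf, hf] at this
    omega
  obtain ⟨k, hk⟩ : ∃ k : Fin 4, ∀ l, l ≠ k → v ≠ f l := by
    by_cases h : ∃ k, v = f k
    · obtain ⟨k, rfl⟩ := h
      exact ⟨k, fun l hl => hne k l hl.symm⟩
    · exact ⟨0, fun l _ e => h ⟨l, e⟩⟩
  obtain ⟨a, b, c, hab, hac, hbc, ha, hb, hc⟩ : ∃ a b c : Fin 4,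
      a ≠ b ∧ a ≠ c ∧ b ≠ c ∧ a ≠ k ∧ b ≠ k ∧ c ≠ k := by
    clear hk; revert k; decide
  exact ⟨f a, f b, f c, hne _ _ hab, hne _ _ hac, hne _ _ hbc, hf' a (hk a ha), hf' b (hk b hb),
    hf' c (hk c hc)⟩

end Universal

/-! ### Arcs in a subdivision -/

section Arcs

variable {U : Type*} {H : SimpleGraph U} {k : H.edgeSet → ℕ}

/-- `l` consecutive inner vertices of the path that replaces the edge `e`, from the number `a` on. -/
def arc (e : H.edgeSet) (a l : ℕ) : Set (U ⊕ (Σ e : H.edgeSet, Fin (k e))) :=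
  {x | ∃ y, x = .inr y ∧ y.1 = e ∧ a ≤ (y.2 : ℕ) ∧ (y.2 : ℕ) < a + l}

theorem inl_notMem_arc {e : H.edgeSet} {a l : ℕ} (u : U) : .inl u ∉ arc (k := k) e a l := by
  simp [arc]

theorem inr_mem_arc {e e' : H.edgeSet} {a l : ℕ} {i : Fin (k e')} :
    .inr ⟨e', i⟩ ∈ arc (k := k) e a l ↔ e' = e ∧ a ≤ (i : ℕ) ∧ (i : ℕ) < a + l :=
  ⟨fun ⟨y, hy, h⟩ => by obtain rfl := Sum.inr_injective hy; exact h, fun h => ⟨_, rfl, h⟩⟩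

theorem arc_disjoint {e e' : H.edgeSet} (h : e ≠ e') (a b l m : ℕ) :
    Disjoint (arc (k := k) e a l) (arc e' b m) :=
  Set.disjoint_left.2 fun _ ⟨_, hy, he, _⟩ ⟨_, hz, he', _⟩ =>
    h (he ▸ he' ▸ (Sum.inr_injective (hy.symm.trans hz) ▸ rfl))

/-- Two different arcs of the same length are not comparable. -/
theorem arc_left_unique {e : H.edgeSet} {a b l : ℕ} (hl : 0 < l) (ha : a + l ≤ k e)
    (h : arc (k := k) e a l ⊆ arc e b l) : a = b := by
  have h₁ := inr_mem_arc.1 (h (inr_mem_arc (i := ⟨a, by omega⟩).2 ⟨rfl, le_rfl, by simp; omega⟩))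
  have h₂ := inr_mem_arc.1 (h (inr_mem_arc (i := ⟨a + l - 1, by omega⟩).2
    ⟨rfl, by simp; omega, by simp; omega⟩))
  simp at h₁ h₂
  omega

variable [LinearOrder U]

theorem subdivision_adj_inl_inl {u v : U} (h : H.Adj u v) (hk : k ⟨s(u, v), h⟩ = 0) :
    (subdivision H k).Adj (.inl u) (.inl v) :=
  (SimpleGraph.fromRel_adj ..).2 ⟨by simpa using h.ne, .inl ⟨h, hk⟩⟩

theorem subdivision_adj_inf (e : H.edgeSet) {i : Fin (k e)} (hi : (i : ℕ) = 0) :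
    (subdivision H k).Adj (.inr ⟨e, i⟩) (.inl e.1.inf) :=
  (SimpleGraph.fromRel_adj ..).2 ⟨by simp, .inr (.inl ⟨rfl, hi⟩)⟩

theorem subdivision_adj_sup (e : H.edgeSet) {i : Fin (k e)} (hi : (i : ℕ) + 1 = k e) :
    (subdivision H k).Adj (.inr ⟨e, i⟩) (.inl e.1.sup) :=
  (SimpleGraph.fromRel_adj ..).2 ⟨by simp, .inr (.inr ⟨rfl, hi⟩)⟩

theorem subdivision_adj_inr_inr (e : H.edgeSet) {i j : Fin (k e)} (hij : (i : ℕ) + 1 = j) :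
    (subdivision H k).Adj (.inr ⟨e, i⟩) (.inr ⟨e, j⟩) :=
  (SimpleGraph.fromRel_adj ..).2 ⟨fun h => by
    have : i = j := by simpa using h
    subst this; omega, .inl ⟨rfl, hij⟩⟩

theorem arc_connected {e : H.edgeSet} {a l : ℕ} (hl : 0 < l) (ha : a + l ≤ k e) :
    ((subdivision H k).induce (arc (k := k) e a l)).Connected := by
  rw [SimpleGraph.connected_iff_exists_forall_reachable]
  have mem : ∀ (j : ℕ) (hj : j < l), .inr ⟨e, ⟨a + j, by omega⟩⟩ ∈ arc (k := k) e a l :=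
    fun j hj => inr_mem_arc.2 ⟨rfl, by simp, by simpa⟩
  refine ⟨⟨_, mem 0 hl⟩, ?_⟩
  have key : ∀ (j : ℕ) (hj : j < l),
      ((subdivision H k).induce (arc (k := k) e a l)).Reachable ⟨_, mem 0 hl⟩ ⟨_, mem j hj⟩ := by
    intro j
    induction j with
    | zero => exact fun _ => .rfl
    | succ j ih =>
      intro hj
      refine (ih (by omega)).trans (SimpleGraph.Adj.reachable ?_)
      exact subdivision_adj_inr_inr e (by simp [Nat.add_assoc])
  rintro ⟨_, ⟨e', i⟩, rfl, h, h₁, h₂⟩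
  obtain rfl : e' = e := h
  replace h₁ : a ≤ (i : ℕ) := h₁
  replace h₂ : (i : ℕ) < a + l := h₂
  have e : (⟨a + (i - a), by omega⟩ : Fin (k e')) = i := Fin.ext (by simp; omega)
  simpa only [e] using key (i - a) (by omega)

/-- From an inner vertex of a subdivided edge, one can walk down to the first end of the edge. -/
theorem reachable_inf {S : Set (U ⊕ (Σ e : H.edgeSet, Fin (k e)))} (hS : ∀ u, .inl u ∈ S)
    {e : H.edgeSet} {i : Fin (k e)} (h : ∀ j ≤ i, .inr ⟨e, j⟩ ∈ S) :
    ((subdivision H k).induce S).Reachable ⟨.inr ⟨e, i⟩, h i le_rfl⟩ ⟨.inl e.1.inf, hS _⟩ := by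
  obtain ⟨i, hi⟩ := i
  induction i with
  | zero => exact SimpleGraph.Adj.reachable (subdivision_adj_inf e rfl)
  | succ i ih =>
    have h' : (⟨i, by omega⟩ : Fin (k e)) ≤ ⟨i + 1, hi⟩ := by simp
    refine SimpleGraph.Reachable.trans (SimpleGraph.Adj.reachable ?_)
      (ih (by omega) fun j hj => h j (hj.trans h'))
    exact (subdivision_adj_inr_inr e rfl).symm

/-- From an inner vertex of a subdivided edge, one can walk up to the last end of the edge. -/
theorem reachable_sup {S : Set (U ⊕ (Σ e : H.edgeSet, Fin (k e)))} (hS : ∀ u, .inl u ∈ S)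
    {e : H.edgeSet} {i : Fin (k e)} (h : ∀ j ≥ i, .inr ⟨e, j⟩ ∈ S) :
    ((subdivision H k).induce S).Reachable ⟨.inr ⟨e, i⟩, h i le_rfl⟩ ⟨.inl e.1.sup, hS _⟩ := by
  obtain ⟨i, hi⟩ := i
  induction hd : k e - (i + 1) generalizing i with
  | zero => exact SimpleGraph.Adj.reachable (subdivision_adj_sup e (by simp; omega))
  | succ d ih =>
    have h' : (⟨i, hi⟩ : Fin (k e)) ≤ ⟨i + 1, by omega⟩ := by simp
    refine SimpleGraph.Reachable.trans (SimpleGraph.Adj.reachable ?_)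
      (ih (i + 1) (by omega) (fun j hj => h j (h'.trans hj)) (by omega))
    exact subdivision_adj_inr_inr e rfl

end Arcs

/-! ### The representation in a subdivision of the butterfly -/

section Butterfly

/-- The edge of the first triangle of `B` opposite to the center. -/
def edgeOneTwo : graphB.edgeSet := ⟨s(1, 2), by simp [graphB]⟩

/-- The edge of the second triangle of `B` opposite to the center. -/
def edgeThreeFour : graphB.edgeSet := ⟨s(3, 4), by simp [graphB]⟩

theorem edgeOneTwo_ne_edgeThreeFour : edgeOneTwo ≠ edgeThreeFour := fun h => by
  have : s((1 : Fin 5), 2) = s(3, 4) := congrArg Subtype.val h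
  simp at this

/-- Each of the two triangles becomes a long cycle, by subdividing the edge opposite to the
center. -/
def cycleLengths (n m : ℕ) (e : graphB.edgeSet) : ℕ :=
  if e = edgeOneTwo then 2 * n else if e = edgeThreeFour then 2 * m else 0

theorem cycleLengths_edgeOneTwo (n m : ℕ) : cycleLengths n m edgeOneTwo = 2 * n := by
  simp [cycleLengths]

theorem cycleLengths_edgeThreeFour (n m : ℕ) : cycleLengths n m edgeThreeFour = 2 * m := by
  simp [cycleLengths, edgeOneTwo_ne_edgeThreeFour.symm]

/-- What remains of the two cycles when an arc is removed from each is connected through the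
center. -/
theorem compl_arcs_connected (n m a b : ℕ) :
    ((subdivision graphB (cycleLengths n m)).induce
      (arc edgeOneTwo a n ∪ arc edgeThreeFour b m)ᶜ).Connected := by
  set S : Set (Fin 5 ⊕ (Σ e : graphB.edgeSet, Fin (cycleLengths n m e))) :=
    (arc edgeOneTwo a n ∪ arc edgeThreeFour b m)ᶜ with hS
  have hinl : ∀ u, .inl u ∈ S := fun u => by simp [hS, inl_notMem_arc]
  have hne := edgeOneTwo_ne_edgeThreeFour
  have spoke : ∀ u : Fin 5, ((subdivision graphB (cycleLengths n m)).induce S).Reachable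
      ⟨.inl u, hinl u⟩ ⟨.inl 0, hinl 0⟩ := by
    have adj : ∀ u : Fin 5, u ≠ 0 → (subdivision graphB (cycleLengths n m)).Adj (.inl u) (.inl 0) := by
      intro u hu
      have h : graphB.Adj u 0 := by
        fin_cases u <;> simp [graphB] at hu ⊢
      refine subdivision_adj_inl_inl h ?_
      rw [cycleLengths, if_neg, if_neg]
      · intro h
        have : s(u, (0 : Fin 5)) = s(3, 4) := congrArg Subtype.val h
        simp at this
      · intro h
        have : s(u, (0 : Fin 5)) = s(1, 2) := congrArg Subtype.val h
        simp at this
    intro u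
    by_cases hu : u = 0
    · subst hu; exact .rfl
    · exact SimpleGraph.Adj.reachable (adj u hu)
  rw [SimpleGraph.connected_iff_exists_forall_reachable]
  refine ⟨⟨.inl 0, hinl 0⟩, ?_⟩
  rintro ⟨u | ⟨e, i⟩, hx⟩
  · exact (spoke u).symm
  · have key : (∀ j ≤ i, .inr ⟨e, j⟩ ∈ S) ∨ (∀ j ≥ i, .inr ⟨e, j⟩ ∈ S) := by
      have hi := i.2
      simp only [hS, Set.mem_compl_iff, Set.mem_union, inr_mem_arc, ge_iff_le, Fin.le_def] at hx ⊢
      by_cases he : e = edgeOneTwo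
      · subst he
        simp only [hne, true_and, false_and, or_false] at hx ⊢
        by_cases h : (i : ℕ) < a
        · left; intro j hj; omega
        · right; intro j hj; omega
      · by_cases he' : e = edgeThreeFour
        · subst he'
          simp only [hne.symm, true_and, false_and, false_or] at hx ⊢
          by_cases h : (i : ℕ) < b
          · left; intro j hj; omega
          · right; intro j hj; omega
        · simp [he, he']
    rcases key with h | h
    · exact (spoke _).symm.trans (reachable_inf hinl h).symm
    · exact (spoke _).symm.trans (reachable_sup hinl h).symm

variable {V : Type*} (G : SimpleGraph V)

/-- The vertices of the subgraphs that represent `G'`: with numberings `f` and `g` of the vertices and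
edges of `G`, the vertices become arcs of the first cycle, the edges arcs of the second one, and
a dart becomes the complement of the arcs of its first vertex and of its edge. -/
noncomputable def region {n m : ℕ} (f : V ≃ Fin n) (g : G.edgeSet ≃ Fin m) :
    PrimeVertex G → Set (Fin 5 ⊕ (Σ e : graphB.edgeSet, Fin (cycleLengths n m e)))
  | .inl (.inl v) => arc edgeOneTwo (f v) n
  | .inl (.inr e) => arc edgeThreeFour (g e) m
  | .inr x =>
    let d := (Equiv.ofBijective _ (halfEdge_bijective (G := G))).symm x
    (arc edgeOneTwo (f d.fst) n ∪ arc edgeThreeFour (g ⟨d.edge, d.edge_mem⟩) m)ᶜ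

variable {G} {n m : ℕ} (f : V ≃ Fin n) (g : G.edgeSet ≃ Fin m)

theorem region_dartPoint (d : G.Dart) : region G f g (dartPoint d) =
    (arc edgeOneTwo (f d.fst) n ∪ arc edgeThreeFour (g ⟨d.edge, d.edge_mem⟩) m)ᶜ := by
  have : (Equiv.ofBijective _ (halfEdge_bijective (G := G))).symm (halfEdge d) = d :=
    Equiv.ofBijective_symm_apply_apply ..
  simp [region, this]

/-- The arcs of length `l` on a path with `2 * l` inner vertices have a common vertex. -/
theorem exists_mem_arcs {e : graphB.edgeSet} {l : ℕ} (hl : cycleLengths n m e = 2 * l)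
    (h : 0 < l) : ∃ x, ∀ i : Fin l, x ∈ arc (k := cycleLengths n m) e i l :=
  ⟨.inr ⟨e, ⟨l - 1, by omega⟩⟩, fun i => inr_mem_arc.2 ⟨rfl, by simp; omega, by simp; omega⟩⟩

/-- An arc meets the complement of two arcs, one on the same and one on another path, unless it is
the first of these. -/
theorem inter_compl_nonempty {e e' : graphB.edgeSet} (he : e ≠ e') {l l' : ℕ}
    (hl : cycleLengths n m e = 2 * l) (i j : Fin l) (b : ℕ) :
    (arc (k := cycleLengths n m) e i l ∩ (arc e j l ∪ arc e' b l')ᶜ).Nonempty ↔ i ≠ j := by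
  rw [← Set.sdiff_eq, Set.sdiff_nonempty]
  constructor
  · rintro h rfl
    exact h Set.subset_union_left
  · intro hij h
    have h' := (arc_disjoint (k := cycleLengths n m) he i b l l').subset_left_of_subset_union h
    exact hij (Fin.ext (arc_left_unique (by omega) (by omega) h'))

theorem region_connected (x : PrimeVertex G) :
    ((subdivision graphB (cycleLengths n m)).induce (region G f g x)).Connected := by
  induction x using PrimeVertex.cases with
  | vertex v => exact arc_connected (f v).pos (by rw [cycleLengths_edgeOneTwo]; omega)
  | edge e => exact arc_connected (g e).pos (by rw [cycleLengths_edgeThreeFour]; omega)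
  | dart d => rw [region_dartPoint]; exact compl_arcs_connected ..

theorem region_adj_iff (x y : PrimeVertex G) (hxy : x ≠ y) :
    (primeGraph G).Adj x y ↔ (region G f g x ∩ region G f g y).Nonempty := by
  have hne := edgeOneTwo_ne_edgeThreeFour
  have vertex_edge : ∀ (v : V) (e : G.edgeSet),
      ¬ (region G f g (vertexPoint v) ∩ region G f g (edgePoint e)).Nonempty := fun v e =>
    Set.not_nonempty_iff_eq_empty.2 (arc_disjoint hne _ _ _ _).inter_eq
  have vertex_dart : ∀ (v : V) (d : G.Dart), (primeGraph G).Adj (vertexPoint v) (dartPoint d) ↔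
      (region G f g (vertexPoint v) ∩ region G f g (dartPoint d)).Nonempty := fun v d => by
    rw [region_dartPoint, primeGraph_adj_vertex_dart]
    exact Iff.trans (by simp) (inter_compl_nonempty hne (cycleLengths_edgeOneTwo n m) _ _ _).symm
  have edge_dart : ∀ (e : G.edgeSet) (d : G.Dart), (primeGraph G).Adj (edgePoint e) (dartPoint d) ↔
      (region G f g (edgePoint e) ∩ region G f g (dartPoint d)).Nonempty := fun e d => by
    rw [region_dartPoint, primeGraph_adj_edge_dart, Set.union_comm]
    exact Iff.trans (by simp [Subtype.ext_iff])
      (inter_compl_nonempty hne.symm (cycleLengths_edgeThreeFour n m) _ _ _).symm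
  induction x using PrimeVertex.cases with
  | vertex u =>
    induction y using PrimeVertex.cases with
    | vertex v =>
      obtain ⟨x, hx⟩ := exists_mem_arcs (cycleLengths_edgeOneTwo n m) (f u).pos
      exact iff_of_true (primeGraph_adj_vertex_vertex.2 (by simpa using hxy)) ⟨x, hx _, hx _⟩
    | edge e => exact iff_of_false not_primeGraph_adj_vertex_edge (vertex_edge u e)
    | dart d => exact vertex_dart u d
  | edge e =>
    rw [SimpleGraph.adj_comm, Set.inter_comm]
    induction y using PrimeVertex.cases with
    | vertex v => exact iff_of_false not_primeGraph_adj_vertex_edge (vertex_edge v e)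
    | edge e' =>
      obtain ⟨x, hx⟩ := exists_mem_arcs (cycleLengths_edgeThreeFour n m) (g e).pos
      exact iff_of_true (primeGraph_adj_edge_edge.2 (by simpa using hxy.symm)) ⟨x, hx _, hx _⟩
    | dart d => rw [SimpleGraph.adj_comm, Set.inter_comm]; exact edge_dart e d
  | dart d =>
    rw [SimpleGraph.adj_comm, Set.inter_comm]
    induction y using PrimeVertex.cases with
    | vertex v => exact vertex_dart v d
    | edge e => exact edge_dart e d
    | dart d' =>
      refine iff_of_true (primeGraph_adj_dart_dart.2 fun h => hxy (h ▸ rfl)) ⟨.inl 0, ?_⟩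
      simp [region_dartPoint, inl_notMem_arc]

/-- No region is properly contained in another one. -/
theorem region_eq_of_subset (x y : PrimeVertex G) (h : region G f g x ⊆ region G f g y) :
    region G f g x = region G f g y := by
  have hne := edgeOneTwo_ne_edgeThreeFour
  have h₁ := cycleLengths_edgeOneTwo n m
  have h₂ := cycleLengths_edgeThreeFour n m
  induction x using PrimeVertex.cases with
  | vertex u =>
    obtain ⟨x, hx⟩ := exists_mem_arcs h₁ (f u).pos
    induction y using PrimeVertex.cases with
    | vertex v =>
      have := arc_left_unique (f u).pos (by rw [h₁]; omega) h
      simp only [region, this]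
    | edge e => exact (Set.disjoint_left.1 (arc_disjoint hne _ _ _ _) (hx (f u)) (h (hx _))).elim
    | dart d => rw [region_dartPoint] at h; exact (h (hx _) (.inl (hx _))).elim
  | edge e =>
    obtain ⟨x, hx⟩ := exists_mem_arcs h₂ (g e).pos
    induction y using PrimeVertex.cases with
    | vertex v => exact (Set.disjoint_left.1 (arc_disjoint hne _ _ _ _) (h (hx _)) (hx (g e))).elim
    | edge e' =>
      have := arc_left_unique (g e).pos (by rw [h₂]; omega) h
      simp only [region, this]
    | dart d => rw [region_dartPoint] at h; exact (h (hx _) (.inr (hx _))).elim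
  | dart d =>
    have hd : .inl 0 ∈ region G f g (dartPoint d) := by simp [region_dartPoint, inl_notMem_arc]
    induction y using PrimeVertex.cases with
    | vertex v => exact (inl_notMem_arc _ (h hd)).elim
    | edge e => exact (inl_notMem_arc _ (h hd)).elim
    | dart d' =>
      rw [region_dartPoint, region_dartPoint, Set.compl_subset_compl, Set.union_subset_iff] at h
      have e₁ := arc_left_unique (f d.fst).pos (by rw [h₁]; omega)
        ((arc_disjoint hne _ _ _ _).subset_left_of_subset_union h.1)
      have e₂ := arc_left_unique (g ⟨d.edge, d.edge_mem⟩).pos (by rw [h₂]; omega)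
        ((arc_disjoint hne.symm _ _ _ _).subset_right_of_subset_union h.2)
      rw [region_dartPoint, region_dartPoint, e₁, e₂]

theorem isProperHGraph_primeGraph [Finite V] (G : SimpleGraph V) :
    IsProperHGraph graphB (primeGraph G) := by
  let f := Finite.equivFin V
  let g := Finite.equivFin G.edgeSet
  refine ⟨cycleLengths _ _, fun x => (⊤ : SimpleGraph.Subgraph _).induce (region G f g x),
    ⟨fun x => ?_, fun x y hxy => ?_⟩, fun x y h => ?_⟩
  · exact SimpleGraph.connected_induce_iff.1 (region_connected f g x)
  · exact region_adj_iff f g x y hxy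
  · have := region_eq_of_subset f g x y h.le.1
    exact h.ne (congrArg _ this)

end Butterfly

/-! ### The construction on words -/

open StackProg

section Words

/-- Whether `(i, j, k)` is the code of a vertex of `G'`, where `A` is the adjacency matrix of a graph
`G` off the diagonal: `(i, i, i)` stands for the vertex `i`, `(i, i, k)` with `i < k` for the edge
`{i, k}`, and `(i, j, j)` with `i ≠ j` for the dart from `i` to `j`. -/
def isCode (A : ℕ → ℕ → Bool) (i j k : ℕ) : Bool :=
  i == j && j == k || i == j && (decide (i < k) && A i k) || j == k && (!(i == j) && A i j)

/-- For codes of vertices of `G'`, whether these stand for a vertex and an edge, for a vertex and a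
dart that starts there, or for an edge and one of its darts, in this order. -/
def separated (i j k a b c : ℕ) : Bool :=
  i == j && j == k && (a == b && !(b == c)) ||
    i == j && j == k && (!(a == b) && a == i) ||
    i == j && !(j == k) && (!(a == b) && (a == i && b == k || a == k && b == i))

/-- Whether two codes belong to adjacent vertices of `G'`. -/
def adjacentCodes (i j k a b c : ℕ) : Bool :=
  !(i == a && (j == b && k == c)) && !(separated i j k a b c || separated a b c i j k)

/-- The codes of the vertices of `G'`, for a graph `G` with `n` vertices. -/
def codes (n : ℕ) (A : ℕ → ℕ → Bool) : List (ℕ × ℕ × ℕ) :=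
  (List.range n).flatMap fun i => (List.range n).flatMap fun j => (List.range n).flatMap fun k =>
    if isCode A i j k = true then [(i, j, k)] else []

/-- The bit for a pair of codes, as a word. -/
def adjacencyBit (u v : ℕ × ℕ × ℕ) : List Bool :=
  if adjacentCodes u.1 u.2.1 u.2.2 v.1 v.2.1 v.2.2 = true then [true] else [false]

/-- The code of `G'` as a word. -/
def primeWord (n : ℕ) (A : ℕ → ℕ → Bool) : List Bool :=
  (codes n A).flatMap (fun _ => [true]) ++
    ([false] ++ (codes n A).flatMap fun u => (codes n A).flatMap (adjacencyBit u))

variable {d : ℕ}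

theorem testable_eq (x y : Fin 6) : Testable d fun _ _ ρ => ρ x == ρ y := by
  convert ((testable_lt (d := d) x y).not.and (testable_lt y x).not) using 4 with n A ρ
  rw [Bool.eq_iff_iff]
  simp
  omega

theorem testable_isCode (x y z : Fin 6) (hx : (x : ℕ) < d) (hy : (y : ℕ) < d) (hz : (z : ℕ) < d) :
    Testable d fun _ A ρ => isCode A (ρ x) (ρ y) (ρ z) :=
  (((testable_eq x y).and (testable_eq y z)).or
    ((testable_eq x y).and ((testable_lt x z).and (testable_adj x z hx hz)))).or
    ((testable_eq y z).and ((testable_eq x y).not.and (testable_adj x y hx hy)))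

theorem testable_separated (x y z x' y' z' : Fin 6) :
    Testable d fun _ _ ρ => separated (ρ x) (ρ y) (ρ z) (ρ x') (ρ y') (ρ z') :=
  (((((testable_eq x y).and (testable_eq y z)).and
      ((testable_eq x' y').and (testable_eq y' z').not)).or
    (((testable_eq x y).and (testable_eq y z)).and
      ((testable_eq x' y').not.and (testable_eq x' x)))).or
    (((testable_eq x y).and (testable_eq y z).not).and ((testable_eq x' y').not.and
      (((testable_eq x' x).and (testable_eq y' z)).or
        ((testable_eq x' z).and (testable_eq y' x))))))

theorem testable_adjacentCodes (x y z x' y' z' : Fin 6) :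
    Testable d fun _ _ ρ => adjacentCodes (ρ x) (ρ y) (ρ z) (ρ x') (ρ y') (ρ z') :=
  ((testable_eq x x').and ((testable_eq y y').and (testable_eq z z'))).not.and
    ((testable_separated x y z x' y' z').or (testable_separated x' y' z' x y z)).not

/-- The variables `0, 1, 2` run through the codes. -/
theorem emits_codes_outer {w : ℕ → (ℕ → ℕ → Bool) → ℕ × ℕ × ℕ → List Bool}
    (h : Emits 3 fun n A ρ => w n A (ρ 0, ρ 1, ρ 2)) :
    Emits 0 fun n A _ => (codes n A).flatMap (w n A) := by
  convert Emits.forVar (d := 0) (by omega) (Emits.forVar (d := 1) (by omega)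
    (Emits.forVar (d := 2) (by omega)
      (Emits.ite (testable_isCode 0 1 2 (by simp) (by simp) (by simp)) h emits_nil))) using 4
  simp [codes, List.flatMap_assoc, Function.update, apply_ite]

/-- The variables `3, 4, 5` run through the codes. -/
theorem emits_codes_inner {w : ℕ → (ℕ → ℕ → Bool) → ℕ × ℕ × ℕ → ℕ × ℕ × ℕ → List Bool}
    (h : Emits 6 fun n A ρ => w n A (ρ 0, ρ 1, ρ 2) (ρ 3, ρ 4, ρ 5)) :
    Emits 3 fun n A ρ => (codes n A).flatMap (w n A (ρ 0, ρ 1, ρ 2)) := by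
  convert Emits.forVar (d := 3) (by omega) (Emits.forVar (d := 4) (by omega)
    (Emits.forVar (d := 5) (by omega)
      (Emits.ite (testable_isCode 3 4 5 (by simp) (by simp) (by simp)) h emits_nil))) using 4
  simp [codes, List.flatMap_assoc, Function.update, apply_ite]

theorem emits_adjacencyBit :
    Emits 6 fun _ _ ρ => adjacencyBit (ρ 0, ρ 1, ρ 2) (ρ 3, ρ 4, ρ 5) := by
  simp only [adjacencyBit]
  exact Emits.ite (testable_adjacentCodes 0 1 2 3 4 5) (emits_singleton true)
    (emits_singleton false)

theorem emits_primeWord : Emits 0 fun n A _ => primeWord n A := by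
  have h₂ := emits_codes_inner (w := fun _ _ u v => adjacencyBit u v) emits_adjacencyBit
  have h₃ := emits_codes_outer (w := fun n A u => (codes n A).flatMap (adjacencyBit u)) h₂
  have h₄ := emits_codes_outer (w := fun _ _ _ => [true]) (emits_singleton true)
  have h₅ := h₄.append ((emits_singleton false).append h₃)
  exact h₅

end Words

/-! ### The words describe the constructed graph -/

namespace FinGraph

/-- The graph on the positions of a list whose entries are vertices of `r`. -/
def ofList {α : Type} (L : List α) (r : SimpleGraph α) : FinGraph :=
  ⟨L.length, r.comap L.get⟩

theorem bits_ofList {α : Type} (L : List α) (r : SimpleGraph α) (b : α → α → Bool)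
    (hb : ∀ u v, b u v = true ↔ r.Adj u v) :
    (ofList L r).bits = L.flatMap (fun _ => [true]) ++ ([false] ++ L.flatMap fun u =>
      L.flatMap fun v => if b u v = true then [true] else [false]) := by
  have h₁ : List.replicate L.length true = L.flatMap (fun _ => [true]) := by
    induction L with
    | nil => rfl
    | cons a L ih => simpa [List.replicate_succ] using ih
  have h₂ : ∀ u, (L.flatMap fun v => if b u v = true then [true] else [false]) =
      (List.finRange L.length).map fun j => b u (L.get j) := fun u => by
    conv_lhs => rw [← List.map_get_finRange L]
    rw [List.flatMap_map, List.map_eq_flatMap]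
    congr 1
    funext j
    cases b u (L.get j) <;> rfl
  have h₃ : ∀ i j, @decide ((ofList L r).2.Adj i j) (Classical.propDecidable _) =
      b (L.get i) (L.get j) := fun i j => by
    rw [Bool.eq_iff_iff, hb]
    exact @decide_eq_true_iff _ (Classical.propDecidable _)
  have h₄ : ∀ F : α → List Bool,
      L.flatMap F = (List.finRange L.length).flatMap fun i => F (L.get i) := fun F =>
    (congrArg (List.flatMap F) (List.map_get_finRange L)).symm.trans (List.flatMap_map ..)
  rw [← h₁, h₄ fun u => _]
  simp only [h₂, bits, h₃]
  rfl

/-- The adjacency matrix of `G`, extended by `true` outside of the range of the vertices. -/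
noncomputable def entries (G : FinGraph) (i j : ℕ) : Bool :=
  @decide (∀ (hi : i < G.1) (hj : j < G.1), G.2.Adj ⟨i, hi⟩ ⟨j, hj⟩) (Classical.propDecidable _)

theorem bits_eq_rowMajor (G : FinGraph) :
    G.bits = List.replicate G.1 true ++ false :: rowMajor G.1 G.entries := by
  have h : ∀ {α : Type} (n : ℕ) (f : ℕ → α), (List.range n).map f =
      (List.finRange n).map fun i : Fin n => f i := fun n f => by
    rw [← List.map_coe_finRange_eq_range, List.map_map]
    rfl
  rw [bits, rowMajor, List.flatMap_def, List.flatMap_def, h]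
  congr! 5 with i
  rw [h]
  congr! 1
  funext j
  simp [entries]

end FinGraph

/-- The graph on the codes of the vertices of `G'`. -/
def codeGraph : SimpleGraph (ℕ × ℕ × ℕ) where
  Adj u v := adjacentCodes u.1 u.2.1 u.2.2 v.1 v.2.1 v.2.2 = true
  symm := ⟨fun u v h => by
    have e : adjacentCodes u.1 u.2.1 u.2.2 v.1 v.2.1 v.2.2 =
        adjacentCodes v.1 v.2.1 v.2.2 u.1 u.2.1 u.2.2 := by
      simp only [adjacentCodes, Bool.or_comm (separated u.1 _ _ _ _ _),
        Bool.beq_comm (a := u.1), Bool.beq_comm (a := u.2.1), Bool.beq_comm (a := u.2.2)]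
    exact e ▸ h⟩
  loopless := ⟨fun u h => by simp [adjacentCodes] at h⟩

theorem mem_codes {n : ℕ} {A : ℕ → ℕ → Bool} {i j k : ℕ} :
    (i, j, k) ∈ codes n A ↔ i < n ∧ j < n ∧ k < n ∧ isCode A i j k = true := by
  simp [codes]

/-- Concatenated lists have no duplicates if each has none and its number can be read off from its
entries. -/
theorem nodup_flatMap_range {α : Type*} {n : ℕ} {f : ℕ → List α} (key : α → ℕ)
    (hf : ∀ i, (f i).Nodup) (hkey : ∀ i, ∀ t ∈ f i, key t = i) :
    ((List.range n).flatMap f).Nodup :=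
  List.nodup_flatMap.2 ⟨fun i _ => hf i, List.nodup_range.imp fun {i j} hij t hi hj =>
    hij ((hkey i t hi).symm.trans (hkey j t hj))⟩

theorem nodup_codes (n : ℕ) (A : ℕ → ℕ → Bool) : (codes n A).Nodup := by
  refine nodup_flatMap_range (fun t => t.1) (fun i => nodup_flatMap_range (fun t => t.2.1)
    (fun j => nodup_flatMap_range (fun t => t.2.2) (fun k => ?_) ?_) ?_) ?_
  · split_ifs <;> simp
  · intro k t ht
    split_ifs at ht <;> simp_all
  all_goals
    intro i t ht
    simp at ht
    grind

section Code

variable {N : ℕ} {P : SimpleGraph (Fin N)} {A : ℕ → ℕ → Bool}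

/-- The code of a vertex of `P'`. -/
noncomputable def codeOf : PrimeVertex P → ℕ × ℕ × ℕ
  | .inl (.inl v) => (v, v, v)
  | .inl (.inr e) => (e.1.inf, e.1.inf, e.1.sup)
  | .inr x =>
    let d := (Equiv.ofBijective _ (halfEdge_bijective (G := P))).symm x
    (d.fst, d.snd, d.snd)

theorem codeOf_dartPoint (d : P.Dart) : codeOf (dartPoint d) = (↑d.fst, ↑d.snd, ↑d.snd) := by
  have : (Equiv.ofBijective _ (halfEdge_bijective (G := P))).symm (halfEdge d) = d :=
    Equiv.ofBijective_symm_apply_apply ..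
  simp [codeOf, this]

/-- An edge is given by its ends in increasing order. -/
theorem edge_cases {p : P.edgeSet → Prop}
    (h : ∀ (u v : Fin N) (huv : P.Adj u v), u < v → p ⟨s(u, v), huv⟩) (e : P.edgeSet) : p e := by
  obtain ⟨⟨u, v⟩, huv⟩ := e
  rcases lt_trichotomy u v with hlt | rfl | hlt
  · exact h u v huv hlt
  · exact (P.loopless.irrefl _ huv).elim
  · have := h v u (SimpleGraph.Adj.symm huv) hlt
    convert this using 2
    exact Subtype.ext Sym2.eq_swap

theorem codeOf_edgePoint {u v : Fin N} (huv : P.Adj u v) (hlt : u < v) :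
    codeOf (edgePoint ⟨s(u, v), huv⟩) = (↑u, ↑u, ↑v) := by
  simp [codeOf, hlt.le]

theorem codeOf_mem (hA : ∀ i j : Fin N, P.Adj i j ↔ i ≠ j ∧ A i j = true) (x : PrimeVertex P) :
    codeOf x ∈ codes N A := by
  induction x using PrimeVertex.cases with
  | vertex v => exact mem_codes.2 ⟨v.2, v.2, v.2, by simp [isCode]⟩
  | edge e =>
    induction e using edge_cases with
    | h u v huv hlt =>
      rw [codeOf_edgePoint huv hlt]
      exact mem_codes.2 ⟨u.2, u.2, v.2, by simp [isCode, hlt, ((hA u v).1 huv).2]⟩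
  | dart d =>
    rw [codeOf_dartPoint]
    exact mem_codes.2 ⟨d.fst.2, d.snd.2, d.snd.2, by
      simp [isCode, Fin.val_inj, d.adj.ne, ((hA _ _).1 d.adj).2]⟩

theorem codeOf_injective : Function.Injective (codeOf (P := P)) := by
  intro x y h
  induction x using PrimeVertex.cases with
  | vertex v =>
    induction y using PrimeVertex.cases with
    | vertex w => simp [codeOf, Fin.val_inj] at h; rw [h]
    | edge e =>
      induction e using edge_cases with
      | h u v huv hlt => rw [codeOf_edgePoint huv hlt] at h; simp [codeOf] at h; omega
    | dart d =>
      have := d.adj.ne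
      rw [codeOf_dartPoint] at h; simp [codeOf] at h; omega
  | edge e =>
    induction e using edge_cases with
    | h u v huv hlt =>
      rw [codeOf_edgePoint huv hlt] at h
      induction y using PrimeVertex.cases with
      | vertex w => simp [codeOf] at h; omega
      | edge e =>
        induction e using edge_cases with
        | h u' v' huv' hlt' =>
          rw [codeOf_edgePoint huv' hlt'] at h
          simp [Fin.val_inj] at h
          obtain ⟨rfl, rfl⟩ := h
          rfl
      | dart d =>
        have := d.adj.ne
        rw [codeOf_dartPoint] at h; simp at h; omega
  | dart d =>
    have hd := d.adj.ne
    rw [codeOf_dartPoint] at h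
    induction y using PrimeVertex.cases with
    | vertex w => simp [codeOf] at h; omega
    | edge e =>
      induction e using edge_cases with
      | h u v huv hlt => rw [codeOf_edgePoint huv hlt] at h; simp at h; omega
    | dart d' =>
      rw [codeOf_dartPoint] at h
      simp [Fin.val_inj] at h
      rw [SimpleGraph.Dart.ext d d' (Prod.ext h.1 h.2)]

theorem exists_codeOf_eq (hA : ∀ i j : Fin N, P.Adj i j ↔ i ≠ j ∧ A i j = true) {t : ℕ × ℕ × ℕ}
    (ht : t ∈ codes N A) : ∃ x : PrimeVertex P, codeOf x = t := by
  obtain ⟨i, j, k⟩ := t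
  obtain ⟨hi, hj, hk, h⟩ := mem_codes.1 ht
  simp only [isCode, Bool.or_eq_true, Bool.and_eq_true, beq_iff_eq, decide_eq_true_eq,
    Bool.not_eq_true', beq_eq_false_iff_ne] at h
  rcases h with (⟨rfl, rfl⟩ | ⟨rfl, h₁, h₂⟩) | ⟨rfl, h₁, h₂⟩
  · exact ⟨vertexPoint ⟨i, hi⟩, rfl⟩
  · have h : P.Adj ⟨i, hi⟩ ⟨k, hk⟩ := (hA _ _).2 ⟨by simpa using h₁.ne, h₂⟩
    exact ⟨edgePoint ⟨s(⟨i, hi⟩, ⟨k, hk⟩), h⟩, codeOf_edgePoint h h₁⟩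
  · have h : P.Adj ⟨i, hi⟩ ⟨j, hj⟩ := (hA _ _).2 ⟨by simpa using h₁, h₂⟩
    exact ⟨dartPoint ⟨(⟨i, hi⟩, ⟨j, hj⟩), h⟩, codeOf_dartPoint _⟩

theorem codeGraph_adj {i j k a b c : ℕ} : codeGraph.Adj (i, j, k) (a, b, c) ↔
    (i, j, k) ≠ (a, b, c) ∧
      ¬ (separated i j k a b c = true ∨ separated a b c i j k = true) := by
  simp [codeGraph, adjacentCodes]
  tauto

theorem separated_iff {i j k a b c : ℕ} : separated i j k a b c = true ↔
    ((i = j ∧ j = k) ∧ a = b ∧ b ≠ c ∨ (i = j ∧ j = k) ∧ a ≠ b ∧ a = i) ∨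
      (i = j ∧ j ≠ k) ∧ a ≠ b ∧ (a = i ∧ b = k ∨ a = k ∧ b = i) := by
  simp [separated]

theorem codeGraph_adj_codeOf (x y : PrimeVertex P) :
    codeGraph.Adj (codeOf x) (codeOf y) ↔ (primeGraph P).Adj x y := by
  have vertex_edge : ∀ (v : Fin N) (e : P.edgeSet), ¬ codeGraph.Adj
      (codeOf (vertexPoint (G := P) v)) (codeOf (edgePoint e)) := fun v e => by
    induction e using edge_cases with
    | h u w huw hlt =>
      rw [codeOf_edgePoint huw hlt, codeOf, codeGraph_adj, separated_iff]
      simp; omega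
  have vertex_dart : ∀ (v : Fin N) (d : P.Dart), codeGraph.Adj
      (codeOf (vertexPoint (G := P) v)) (codeOf (dartPoint d)) ↔ (primeGraph P).Adj (vertexPoint v) (dartPoint d) := fun v d => by
    have := d.adj.ne
    rw [codeOf_dartPoint, codeOf, codeGraph_adj, separated_iff, separated_iff,
      primeGraph_adj_vertex_dart]
    simp only [ne_eq, Prod.mk.injEq, Fin.ext_iff] at this ⊢
    grind
  have edge_dart : ∀ (e : P.edgeSet) (d : P.Dart), codeGraph.Adj (codeOf (edgePoint e))
      (codeOf (dartPoint d)) ↔ (primeGraph P).Adj (edgePoint e) (dartPoint d) := fun e d => by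
    induction e using edge_cases with
    | h u w huw hlt =>
      have := d.adj.ne
      rw [codeOf_edgePoint huw hlt, codeOf_dartPoint, codeGraph_adj, separated_iff, separated_iff,
        primeGraph_adj_edge_dart]
      simp only [SimpleGraph.Dart.edge, Sym2.mk, Sym2.eq_iff, ne_eq, Prod.mk.injEq,
        Fin.ext_iff, Fin.lt_def] at this hlt ⊢
      grind
  induction x using PrimeVertex.cases with
  | vertex v =>
    induction y using PrimeVertex.cases with
    | vertex w =>
      rw [codeOf, codeOf, codeGraph_adj, separated_iff, separated_iff, primeGraph_adj_vertex_vertex]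
      simp only [ne_eq, Prod.mk.injEq, Fin.ext_iff]
      grind
    | edge e => exact iff_of_false (vertex_edge v e) not_primeGraph_adj_vertex_edge
    | dart d => exact vertex_dart v d
  | edge e =>
    rw [SimpleGraph.adj_comm, (primeGraph P).adj_comm]
    induction y using PrimeVertex.cases with
    | vertex v => exact iff_of_false (vertex_edge v e) not_primeGraph_adj_vertex_edge
    | edge f =>
      rw [primeGraph_adj_edge_edge, ne_eq, Subtype.ext_iff]
      induction e using edge_cases with
      | h u v huv hlt =>
        induction f using edge_cases with
        | h u' v' huv' hlt' =>
          rw [codeOf_edgePoint huv hlt, codeOf_edgePoint huv' hlt', codeGraph_adj, separated_iff,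
            separated_iff]
          simp only [Sym2.eq_iff, ne_eq, Prod.mk.injEq, Fin.ext_iff, Fin.lt_def] at hlt hlt' ⊢
          grind
    | dart d => rw [SimpleGraph.adj_comm, (primeGraph P).adj_comm]; exact edge_dart e d
  | dart d =>
    rw [SimpleGraph.adj_comm, (primeGraph P).adj_comm]
    induction y using PrimeVertex.cases with
    | vertex v => exact vertex_dart v d
    | edge e => exact edge_dart e d
    | dart d' =>
      have h₁ := d.adj.ne
      have h₂ := d'.adj.ne
      rw [codeOf_dartPoint, codeOf_dartPoint, codeGraph_adj, separated_iff, separated_iff,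
        primeGraph_adj_dart_dart]
      simp only [ne_eq, SimpleGraph.Dart.ext_iff, Prod.ext_iff, Fin.ext_iff] at h₁ h₂ ⊢
      grind

/-- The graph on the list of all codes is `P'`, where `A` is the adjacency matrix of `P` off the
diagonal. -/
theorem nonempty_ofList_codes_iso (hA : ∀ i j : Fin N, P.Adj i j ↔ i ≠ j ∧ A i j = true) :
    Nonempty ((FinGraph.ofList (codes N A) codeGraph).2 ≃g primeGraph P) := by
  let g : PrimeVertex P → {t // t ∈ codes N A} := fun x => ⟨codeOf x, codeOf_mem hA x⟩
  have hg : Function.Bijective g :=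
    ⟨fun x y h => codeOf_injective (congrArg Subtype.val h), fun t =>
      let ⟨x, hx⟩ := exists_codeOf_eq hA t.2
      ⟨x, Subtype.ext hx⟩⟩
  let e := (List.Nodup.getEquiv _ (nodup_codes N A)).trans (Equiv.ofBijective g hg).symm
  refine ⟨⟨e, fun {i j} => ?_⟩⟩
  have he : ∀ i, codeOf (e i) = (codes N A).get i := fun i =>
    congrArg Subtype.val ((Equiv.ofBijective g hg).apply_symm_apply _)
  rw [← codeGraph_adj_codeOf]
  exact iff_of_eq (congrArg₂ codeGraph.Adj (he i) (he j))

end Code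

/-! ### Polynomial-time reductions -/

open StackProg Tape

theorem polynomial_eval_mono (T : Polynomial ℕ) {a b : ℕ} (h : a ≤ b) : T.eval a ≤ T.eval b := by
  rw [Polynomial.eval_eq_sum, Polynomial.eval_eq_sum]
  exact Finset.sum_le_sum fun i _ => Nat.mul_le_mul_left _ (Nat.pow_le_pow_left h i)

namespace FinGraph

/-- Add `c` universal vertices to `G` and apply the construction; up to the numbering of the
vertices, the result is `(pad c G)'`. -/
noncomputable def primeOfPad (c : ℕ) (G : FinGraph) : FinGraph :=
  ofList (codes (G.1 + c) G.entries) codeGraph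

theorem nonempty_primeOfPad_iso (c : ℕ) (G : FinGraph) :
    Nonempty ((primeOfPad c G).2 ≃g primeGraph (pad c G.2)) :=
  nonempty_ofList_codes_iso fun i j => by simp [pad, entries]

theorem bits_primeOfPad (c : ℕ) (G : FinGraph) :
    (primeOfPad c G).bits = primeWord (G.1 + c) G.entries :=
  bits_ofList _ _ _ fun _ _ => Iff.rfl

theorem le_length_bits (G : FinGraph) : G.1 ≤ G.bits.length := by
  simp [bits_eq_rowMajor]

/-- A program that replaces a graph at the front of the input by its image under the construction,
pushed onto the output stack. -/
theorem exists_runs_primeOfPad (c : ℕ) : ∃ (p : StackProg Tape) (T : Polynomial ℕ),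
    ∀ (G : FinGraph) (r o : List Bool) (σ), Runs p (σ, memory (G.bits ++ r) o [] [] [] [])
      (T.eval G.bits.length) (none, memory r ((primeOfPad c G).bits.reverse ++ o) [] [] [] []) := by
  obtain ⟨p, T, h⟩ := emits_primeWord.exists_runs c
  refine ⟨p, T, fun G r o σ => ?_⟩
  have := h G.1 G.entries (fun i j hij => by
    simp only [entries, decide_eq_true_iff]
    intro hi hj
    omega) r o σ
  rw [← bits_primeOfPad] at this
  refine (this.congr ?_ rfl le_rfl).mono (polynomial_eval_mono T G.le_length_bits)
  simp [bits_eq_rowMajor]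

/-- A program that produces the output on the output stack, last bit on top, is completed by
reversing the output; the length of the output is bounded by the running time. -/
theorem runs_seq_move {p : StackProg Tape} {w v : List Bool} {t : ℕ} {σ : Option Bool}
    (h : Runs p (none, memory w [] [] [] [] []) t (σ, memory [] v.reverse [] [] [] [])) :
    Runs (seq p (move out res)) (none, Function.update (fun _ => []) inp w) (t + (t * 3 + 2))
      (none, Function.update (fun _ => []) res v) := by
  have hlen : v.length ≤ t := by
    obtain ⟨n, hn, e⟩ := h
    have := e.length_le out
    simp [memory] at this
    omega
  refine (h.seq (runs_move (by simp) σ _)).congr ?_ ?_ ?_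
  · funext x
    cases x <;> simp [memory]
  · funext x
    cases x <;> simp [memory]
  · simp [memory]
    omega

theorem polyTime_primeOfPad (c : ℕ) : PolyTime encoding encoding (primeOfPad c) := by
  obtain ⟨p, T, h⟩ := exists_runs_primeOfPad c
  refine polyTime_of_runs (seq p (move out res)) inp res (T + (T * 3 + 2)) fun G => ?_
  have := h G [] [] none
  rw [List.append_nil, List.append_nil] at this
  simpa [encoding] using runs_seq_move this

theorem polyTime_pair_primeOfPad (c : ℕ) : PolyTime pairEncoding pairEncoding
    fun p => (primeOfPad c p.1, primeOfPad c p.2) := by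
  obtain ⟨p, T, h⟩ := exists_runs_primeOfPad c
  refine polyTime_of_runs (seq (seq p p) (move out res)) inp res (T + T + ((T + T) * 3 + 2))
    fun ⟨G, H⟩ => ?_
  have h₁ := h G H.bits [] none
  have h₂ := h H [] ((primeOfPad c G).bits.reverse ++ []) none
  rw [List.append_nil, List.append_nil, ← List.reverse_append] at h₂
  rw [List.append_nil] at h₁
  have h₃ := (h₁.mono (polynomial_eval_mono T
    (show _ ≤ (G.bits ++ H.bits).length by simp))).seq (h₂.mono (polynomial_eval_mono T
    (show _ ≤ (G.bits ++ H.bits).length by simp)))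
  simpa [pairEncoding] using runs_seq_move h₃

/-- The construction, applied after adding four universal vertices, preserves and reflects
isomorphism. -/
theorem isomorphic_primeOfPad_iff (G H : FinGraph) :
    (primeOfPad 4 G).Isomorphic (primeOfPad 4 H) ↔ G.Isomorphic H := by
  obtain ⟨φ⟩ := nonempty_primeOfPad_iso 4 G
  obtain ⟨ψ⟩ := nonempty_primeOfPad_iso 4 H
  refine Iff.trans ?_ (nonempty_pad_iso_iff 4 G.2 H.2)
  exact ⟨fun ⟨χ⟩ => (threeNeighbors_pad G.2).nonempty_iso (threeNeighbors_pad H.2)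
      ((φ.symm.trans χ).trans ψ),
    fun ⟨χ⟩ => ⟨(φ.trans (primeGraphIso χ)).trans ψ.symm⟩⟩

end FinGraph

theorem IsRepresentation.of_iso {V V' W : Type*} {K : SimpleGraph W} {G : SimpleGraph V}
    {G' : SimpleGraph V'} {R : V → K.Subgraph} (h : IsRepresentation K G R) (φ : G' ≃g G) :
    IsRepresentation K G' (fun v => R (φ v)) where
  connected v := h.connected (φ v)
  adj_iff u v huv := by
    rw [← φ.map_adj_iff, h.adj_iff _ _ (φ.injective.ne huv)]

theorem IsProperHGraph.of_iso {U V V' : Type*} [LinearOrder U] {H : SimpleGraph U}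
    {G : SimpleGraph V} {G' : SimpleGraph V'} (h : IsProperHGraph H G) (φ : G' ≃g G) :
    IsProperHGraph H G' :=
  let ⟨k, R, hR, hp⟩ := h
  ⟨k, fun v => R (φ v), hR.of_iso φ, fun u v => hp (φ u) (φ v)⟩

theorem isProperHGraph_primeOfPad (c : ℕ) (G : FinGraph) :
    IsProperHGraph graphB (FinGraph.primeOfPad c G).2 :=
  let ⟨φ⟩ := FinGraph.nonempty_primeOfPad_iso c G
  (isProperHGraph_primeGraph (pad c G.2)).of_iso φ

/-- The isomorphism problem of a class reduces to that of all graphs by the identity. -/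
theorem reduces_isomorphism_univ (C : Set FinGraph) :
    (PromiseProblem.isomorphism C).Reduces (PromiseProblem.isomorphism Set.univ) :=
  ⟨id, ⟨Turing.idComputableInPolyTime _⟩, fun _ _ => ⟨⟨trivial, trivial⟩, Iff.rfl⟩⟩

theorem isomorphism_univ_reduces :
    (PromiseProblem.isomorphism Set.univ).Reduces
      (PromiseProblem.isomorphism {G : FinGraph | IsProperHGraph graphB G.2}) :=
  ⟨fun p => (FinGraph.primeOfPad 4 p.1, FinGraph.primeOfPad 4 p.2),
    FinGraph.polyTime_pair_primeOfPad 4, fun p _ =>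
      ⟨⟨isProperHGraph_primeOfPad 4 p.1, isProperHGraph_primeOfPad 4 p.2⟩,
        (FinGraph.isomorphic_primeOfPad_iff p.1 p.2).symm⟩⟩

theorem mainTheorem5 :
    -- the isomorphism problem for proper `B`-graphs is GI-complete
    (PromiseProblem.isomorphism {G : FinGraph | IsProperHGraph graphB G.2}).GIComplete ∧
    -- the graph `G'` can be constructed in polynomial time
    (∃ f : FinGraph → FinGraph, PolyTime FinGraph.encoding FinGraph.encoding f ∧
      ∀ G : FinGraph, Nonempty ((f G).2 ≃g primeGraph G.2)) ∧
    -- `G'` is a proper `B`-graph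
    (∀ (V : Type*) [Finite V] (G : SimpleGraph V), IsProperHGraph graphB (primeGraph G)) ∧
    -- for minimum degree at least three, the construction preserves and reflects isomorphism
    (∀ (V W : Type*) [Fintype V] [Fintype W] (G : SimpleGraph V) (H : SimpleGraph W)
      [DecidableRel G.Adj] [DecidableRel H.Adj],
      (∀ v, 3 ≤ G.degree v) → (∀ w, 3 ≤ H.degree w) →
        (Nonempty (G ≃g H) ↔ Nonempty (primeGraph G ≃g primeGraph H))) := by
  refine ⟨⟨isomorphism_univ_reduces, reduces_isomorphism_univ _⟩, ⟨FinGraph.primeOfPad 0,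
    FinGraph.polyTime_primeOfPad 0, fun G => ?_⟩, fun V _ G => isProperHGraph_primeGraph G,
    fun V W _ _ G H _ _ hG hH => ⟨fun ⟨φ⟩ => ⟨primeGraphIso φ⟩, fun ⟨ψ⟩ =>
      (threeNeighbors_of_degree hG).nonempty_iso (threeNeighbors_of_degree hH) ψ⟩⟩
  obtain ⟨φ⟩ := FinGraph.nonempty_primeOfPad_iso 0 G
  exact ⟨φ.trans (primeGraphIso (padZeroIso G.2))⟩
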